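/- **Theorem (Binary fundamental theorem for $\lambda$-WHR).** *Syntax.* Fix sets of actors $a$ and locks $\sigma$, and let $\Sigma$ range over sets of locks. A policy $p$ is a set of clauses $\Sigma\Rightarrow a$. Fix a policy $\mathrm{LP}(\sigma)$ for every lock. Types are $A ::= \mathsf{unit}\mid\mathsf{nat}\mid\tau+\tau\mid\tau\times\tau\mid\mathsf{ref}\,\tau\mid\tau\xrightarrow{\Sigma,pc}\tau$, with annotated types $\tau ::= A^p$ ($pc$ a policy). Expressions (up to renaming of bound variables; $l$ ranges over a countably infinite set of locations) are $$e ::= x\mid()\mid n\mid\lambda x.e\mid(e,e)\mid\mathsf{fst}\,e\mid\mathsf{snd}\,e\mid\mathsf{inl}\,e\mid\mathsf{inr}\,e\mid\mathsf{case}(e,x.e,y.e)\mid e\,e\mid\mathsf{new}(e,\tau)\mid{!e}\mid e:=e\mid\mathsf{open}_\sigma e\mid\mathsf{opened}_\sigma e\mid\mathsf{close}_\sigma e\mid\mathsf{closed}_\sigma e\mid\mathsf{when}_\sigma e\,e\mid l.$$ Values are $v ::= \lambda x.e\mid(v,v)\mid\mathsf{inl}\,v\mid\mathsf{inr}\,v\mid()\mid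 l\mid n$. Substitution is capture-avoiding. *Policies.* $p\sqsubseteq q$ iff for every $(\Sigma\Rightarrow a)\in q$ there is $(\Sigma'\Rightarrow a)\in p$ with $\Sigma'\subseteq\Sigma$. Put $\bot=\{\emptyset\Rightarrow a\mid a\text{ an actor}\}$, $p\sqcup q=\{\Sigma_1\cup\Sigma_2\Rightarrow a\mid(\Sigma_1\Rightarrow a)\in p,(\Sigma_2\Rightarrow a)\in q\}$, $p[\Sigma]=\{\Sigma_1\setminus\Sigma\Rightarrow a\mid(\Sigma_1\Rightarrow a)\in p\}$, $A^p[\Sigma]=A^{p[\Sigma]}$. In $q\sqsubseteq A^p$ only $p$ counts. *Reduction.* A state $S$ maps finitely many locations to pairs $(v,\tau)$ of a value and a type. Observations are $\epsilon$, $l_\tau(v)$ (write), $\mathrm{op}(\sigma)$, $\mathrm{unop}(\sigma)$, $\mathrm{cl}(\sigma)$, $\mathrm{uncl}(\sigma)$; $\mathrm{pol}(l_{A^p}(v))=p$, $\mathrm{pol}(\epsilon)$ is undefined and the four others have policy $\mathrm{LP}(\sigma)$. A step $e,\Sigma,S\to e',S',\omega,\Sigma'$ has open locks $\Sigma$ and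 active lock set $\Sigma'$ (the lock set at the redex). The axioms are as follows, where $\Sigma'=\Sigma$, and $S'=S$ and $\omega=\epsilon$ unless said otherwise: - $\mathsf{open}_\sigma e\to\mathsf{opened}_\sigma e$ with $\mathrm{op}(\sigma)$; $\mathsf{opened}_\sigma v\to v$ with $\mathrm{unop}(\sigma)$; $\mathsf{close}_\sigma e\to\mathsf{closed}_\sigma e$ with $\mathrm{cl}(\sigma)$; $\mathsf{closed}_\sigma v\to v$ with $\mathrm{uncl}(\sigma)$; - $!l\to v$ if $S(l)=(v,\tau)$; $\mathsf{new}(v,\tau)\to l$ for any $l\notin\mathrm{dom}(S)$, with $S'=S[l\mapsto(v,\tau)]$ and $l_\tau(v)$; $l:=v\to()$ if $l\in\mathrm{dom}(S)$ has type $\tau$ in $S$, with $S'=S[l\mapsto(v,\tau)]$ and $l_\tau(v)$; - $(\lambda x.e)\,v\to e[v/x]$; $\mathsf{fst}(v,v')\to v$; $\mathsf{snd}(v,v')\to v'$; $\mathsf{case}(\mathsf{inl}\,v,x.e',y.e'')\to e'[v/x]$; $\mathsf{case}(\mathsf{inr}\,v,x.e',y.e'')\to e''[v/y]$; - $\mathsf{when}_\sigma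 v\,e'\to v$ if $\sigma\in\Sigma$; $\mathsf{when}_\sigma e\,v\to v$ if $\sigma\notin\Sigma$. Steps are closed under the left-to-right call-by-value contexts $\mathsf{new}(\cdot,\tau)$, $!\cdot$, $\cdot:=e$, $l:=\cdot$, $\cdot\,e$, $(\lambda x.e)\,\cdot$, $(\cdot,e)$, $(v,\cdot)$, $\mathsf{fst}$, $\mathsf{snd}$, $\mathsf{inl}$, $\mathsf{inr}$, $\mathsf{case}(\cdot,\dots)$, under $\mathsf{opened}_\sigma\cdot$ and $\mathsf{closed}_\sigma\cdot$, whose body is reduced with open locks $\Sigma\cup\{\sigma\}$ and $\Sigma\setminus\{\sigma\}$ respectively, and under $\mathsf{when}_\sigma\cdot\,e'$ if $\sigma\in\Sigma$ and $\mathsf{when}_\sigma e\,\cdot$ if $\sigma\notin\Sigma$; observation and active lock set are those of the inner step. *Subtyping.* $A^p<:B^q$ iff $p\sqsubseteq q$ and $A<:B$; $\mathsf{unit}$, $\mathsf{nat}$ and $\mathsf{ref}\,\tau$ are subtypes only of themselves; $\times$ and $+$ are covariant; $(\tau_1\xrightarrow{\Sigma,pc}\tau_2)<:(\tau_0\xrightarrow{\Sigma',pc'}\tau_3)$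 iff $\tau_0<:\tau_1$, $\tau_2<:\tau_3$, $pc'\sqsubseteq pc$ and $\Sigma\subseteq\Sigma'$. *Typing.* A state environment $\theta$ is a partial map from locations to annotated types; $\theta'\sqsupseteq\theta$ means that $\theta'$ extends $\theta$. Write $\Sigma\vdash_{pc}e:\tau$ for $\Gamma;\Sigma;\theta\vdash_{pc}e:\tau$. The rules are: - $\Sigma\vdash_{pc}x:\Gamma(x)$; $\Sigma\vdash_{pc}():\mathsf{unit}^\bot$; $\Sigma\vdash_{pc}n:\mathsf{nat}^\bot$; $\Sigma\vdash_{pc}l:(\mathsf{ref}\,\theta(l))^\bot$ for $l\in\mathrm{dom}\,\theta$; - $\Sigma\vdash_{pc}\lambda x.e:(\tau_1\xrightarrow{\Sigma',pc'}\tau_2)^\bot$ if $\Gamma,x{:}\tau_1;\Sigma';\theta\vdash_{pc'}e:\tau_2$; - $\Sigma\vdash_{pc}\mathsf{open}_\sigma e:\tau$ and $\Sigma\vdash_{pc}\mathsf{opened}_\sigma e:\tau$ if $\Sigma\cup\{\sigma\}\vdash_{pc}e:\tau$ and $pc\sqsubseteq\mathrm{LP}(\sigma)$; the same for $\mathsf{close}_\sigma$,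 $\mathsf{closed}_\sigma$ with $\Sigma\setminus\{\sigma\}$; - $(e_1,e_2):(\tau_1\times\tau_2)^\bot$ if $e_i:\tau_i$; $\mathsf{fst}\,e:\tau_1$ if $e:(\tau_1\times\tau_2)^p$ and $p\sqsubseteq\tau_1$, and symmetrically for $\mathsf{snd}$; $\mathsf{inl}\,e:(\tau_1+\tau_2)^\bot$ if $e:\tau_1$, and symmetrically for $\mathsf{inr}$ (all with the same $\Gamma,\Sigma,\theta,pc$); - $\Sigma\vdash_{pc}\mathsf{case}(e,x.e_1,y.e_2):\tau$ if $\Sigma\vdash_{pc}e:(\tau_1+\tau_2)^p$, $p\sqsubseteq\tau$, $\Gamma,x{:}\tau_1;\Sigma;\theta\vdash_{pc\sqcup p}e_1:\tau$ and $\Gamma,y{:}\tau_2;\Sigma;\theta\vdash_{pc\sqcup p}e_2:\tau$; - $\Sigma\vdash_{pc}e:\tau$ if $\Sigma\vdash_{pc'}e:\tau'$, $pc\sqsubseteq pc'$ and $\tau'<:\tau$; - $\Sigma\vdash_{pc}e_1\,e_2:\tau_2$ if $\Sigma\vdash_{pc}e_1:(\tau_1\xrightarrow{\Sigma',pc'}\tau_2)^p$,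 $\Sigma\vdash_{pc}e_2:\tau_1'$, $p\sqsubseteq\tau_2$, $pc\sqcup p\sqsubseteq pc'$, $\tau_1'<:\tau_1$ and $\Sigma\supseteq\Sigma'$; - $\Sigma\vdash_{pc}{!e}:\tau'$ if $\Sigma\vdash_{pc}e:(\mathsf{ref}\,\tau)^p$, $p\sqsubseteq\tau'$ and $\tau<:\tau'$; - $\Sigma\vdash_{pc}\mathsf{new}(e,\tau):(\mathsf{ref}\,\tau)^\bot$ if $\Sigma\vdash_{pc}e:\tau'$, $pc\sqsubseteq\tau$ and $\tau'[\Sigma]<:\tau$; - $\Sigma\vdash_{pc}e:=e':\mathsf{unit}^\bot$ if $\Sigma\vdash_{pc}e:(\mathsf{ref}\,\tau')^p$, $\Sigma\vdash_{pc}e':\tau$, $\tau[\Sigma]<:\tau'$ and $pc\sqcup p\sqsubseteq\tau'$; - $\Sigma\vdash_{pc}\mathsf{when}_\sigma e_1\,e_2:\tau$ if $\Sigma\cup\{\sigma\}\vdash_{pc\sqcup\mathrm{LP}(\sigma)}e_1:\tau$, $\Sigma\vdash_{pc\sqcup\mathrm{LP}(\sigma)}e_2:\tau$ and $\mathrm{LP}(\sigma)\sqsubseteq\tau$.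 *Unary relation.* By recursion on $m\in\mathbb N$ and on types: $(v,\theta,m)\in\lfloor A^p\rfloor_V$ iff $(v,\theta,m)\in\lfloor A\rfloor_V$; $\lfloor\mathsf{unit}\rfloor_V$ and $\lfloor\mathsf{nat}\rfloor_V$ contain $()$ and the numerals respectively; products and sums are componentwise; $(l,\theta,m)\in\lfloor\mathsf{ref}\,\tau\rfloor_V$ iff $\theta(l)=\tau$; $(\lambda x.e,\theta,m)\in\lfloor\tau_1\xrightarrow{\Sigma,pc}\tau_2\rfloor_V$ iff for all $\theta'\sqsupseteq\theta$, $m'<m$ and $(v,\theta',m')\in\lfloor\tau_1\rfloor_V$ one has $(e[v/x],\theta',m')\in\lfloor\tau_2\rfloor_E^{pc}$. Write $(S,m)\triangleright\theta$ if every $l\in\mathrm{dom}(\theta)$ is in $\mathrm{dom}(S)$, has type $\theta(l)$ in $S$, and holds a value $v$ with $(v,\theta,m)\in\lfloor\theta(l)\rfloor_V$. Finally $(e,\theta,m)\in\lfloor\tau\rfloor_E^{pc}$ iff $(e,\theta,m)\in\lfloor\tau\rfloor_V$, or $e$ is not a value and for all $\theta'\sqsupseteq\theta$, $m'<m$, all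 $S$ with $(S,m')\triangleright\theta'$ and all steps $e,\Sigma,S\to e',S',\omega,\Sigma'$: $\omega=\epsilon$ or $pc\sqsubseteq\mathrm{pol}(\omega)$, and there is $\theta''\sqsupseteq\theta'$ with $(S',m')\triangleright\theta''$ and $(e',\theta'',m')\in\lfloor\tau\rfloor_E^{pc}$. *Binary relation.* A world $W=(\theta_1,\theta_2,\beta)$ consists of two state environments and a partial bijection $\beta$ between locations; $W'\sqsupseteq W$ means that all three components are extended. An attacker $\mathcal A=(a,\Sigma_{\mathcal A})$ is an actor with a lock set; $p\sqsubseteq\mathcal A$ means $p\sqsubseteq\{\Sigma_{\mathcal A}\Rightarrow a\}$, and $\Sigma\sqsubseteq\mathcal A$ means $\Sigma\subseteq\Sigma_{\mathcal A}$. The observation $\omega$ is visible if $\mathrm{pol}(\omega)$ is defined and $\sqsubseteq\mathcal A$. Write $\Sigma\approx_{\mathcal A}\Sigma'$ if $\Sigma$ and $\Sigma'$ contain the same locks $\sigma$ with $\mathrm{LP}(\sigma)\sqsubseteq\mathcal A$. By recursion on $m$ and types, for a fixed $\mathcal A$: - $(v,v',W,m)\in\lceil A^p\rceil_V$ iff $p\sqsubseteq\mathcal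 A$ and $(v,v',W,m)\in\lceil A\rceil_V$, or $p\not\sqsubseteq\mathcal A$, $(v,W.\theta_1,m)\in\lfloor A\rfloor_V$ and $(v',W.\theta_2,m)\in\lfloor A\rfloor_V$. At $\mathsf{unit}$ and $\mathsf{nat}$ both values are $()$, respectively the same numeral; products and sums are componentwise (same injection on both sides); $(l,l',W,m)\in\lceil\mathsf{ref}\,\tau\rceil_V$ iff $W.\theta_1(l)=\tau=W.\theta_2(l')$ and $(l,l')\in W.\beta$. - $(\lambda x.e_1,\lambda x.e_2,W,m)\in\lceil B\rceil_V$ for $B=\tau_1\xrightarrow{\Sigma,pc}\tau_2$ iff $(\lambda x.e_i,W.\theta_i,m)\in\lfloor B\rfloor_V$ for $i=1,2$, and for all $W'\sqsupseteq W$, $m'<m$, $(v_1,v_2,W',m')\in\lceil\tau_1\rceil_V$ and $\Sigma_1,\Sigma_2\supseteq\Sigma$ with $\Sigma_1\approx_{\mathcal A}\Sigma_2$, $(e_1[v_1/x],e_2[v_2/x],W',\Sigma_1,\Sigma_2,m')\in\lceil\tau_2\rceil_E$. - $(S_1,S_2,m)\triangleright_{\mathcal A}W$ iff $(S_i,m)\triangleright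 W.\theta_i$ for $i=1,2$, $W.\beta\subseteq\mathrm{dom}(W.\theta_1)\times\mathrm{dom}(W.\theta_2)$, and for all $(l_1,l_2)\in W.\beta$, $W.\theta_1(l_1)=W.\theta_2(l_2)=:\tau$ and the values stored by $S_1$ at $l_1$ and $S_2$ at $l_2$ are related in $\lceil\tau\rceil_V$ at $(W,m)$. - $\omega\cong_{W,m}\omega'$ (indistinguishability) iff neither is visible, or $\omega=\omega'$ is not a write, or $\omega=l_\tau(v)$, $\omega'=l'_\tau(v')$ with $(v,v',W,m)\in\lceil\tau\rceil_V$ and $(l,l')\in W.\beta$. $\omega\equiv_{W,m}\omega'$ (irrelevance) iff at least one of them is not visible, or $\omega=\omega'$ is not a write, or $\omega=l_\tau(v)$, $\omega'=l'_\tau(v')$ with $(v,v',W,m)\in\lceil\tau\rceil_V$. - $(e_1,e_2,W,\Sigma,\Sigma',m)\in\lceil\tau\rceil_E$ iff $(e_1,e_2,W,m)\in\lceil\tau\rceil_V$, or $\Sigma\approx_{\mathcal A}\Sigma'$ and for all $\Sigma_1\supseteq\Sigma$, $\Sigma_2\supseteq\Sigma'$ with $\Sigma_1\approx_{\mathcal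 A}\Sigma_2$, all $W'\sqsupseteq W$, $m'<m$ and all $(S_1,S_2,m')\triangleright_{\mathcal A}W'$, at least one of the following holds: (Par) $e_1,e_2$ are not values, and for all steps $e_1,\Sigma_1,S_1\to e_1',S_1',\omega,\Sigma_1'$ and $e_2,\Sigma_2,S_2\to e_2',S_2',\omega',\Sigma_2'$, if $\omega\equiv_{W',m'}\omega'$ or $\Sigma_1'\sqsubseteq\mathcal A$ or $\Sigma_2'\sqsubseteq\mathcal A$, then there is $W''\sqsupseteq W'$ with $(S_1',S_2',m')\triangleright_{\mathcal A}W''$, $\omega\cong_{W'',m'}\omega'$ and $(e_1',e_2',W'',\Sigma,\Sigma',m')\in\lceil\tau\rceil_E$; (L) $e_1$ is not a value, and for every step $e_1,\Sigma_1,S_1\to e_1',S_1',\omega,\Sigma_1'$, $\omega$ is not visible and there is $W''\sqsupseteq W'$ with $(S_1',S_2,m')\triangleright_{\mathcal A}W''$ and $(e_1',e_2,W'',\Sigma,\Sigma',m')\in\lceil\tau\rceil_E$; (R) the mirror image of (L) for steps of $e_2$ from $\Sigma_2,S_2$. - A binary substitution $\gamma=(\gamma_1,\gamma_2)$ satisfies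 $(\gamma,W,m)\in\lceil\Gamma\rceil_V$ iff $(\gamma_1(x),\gamma_2(x),W,m)\in\lceil\Gamma(x)\rceil_V$ for all $x\in\mathrm{dom}(\Gamma)$. **Claim.** Suppose $\Gamma;\Sigma;\theta\vdash_{pc}e:\tau$. Then for every attacker $\mathcal A$, step index $m\in\mathbb N$, world $W$ and binary substitution $\gamma$ such that $(\gamma,W,m)\in\lceil\Gamma\rceil_V$ (for $\mathcal A$), $W.\theta_1\sqsupseteq\theta$, $W.\theta_2\sqsupseteq\theta$ and $(l,l)\in W.\beta$ for every $l\in\mathrm{dom}(\theta)$, one has $$(\gamma_1(e),\gamma_2(e),W,\Sigma,\Sigma,m)\in\lceil\tau\rceil_E .$$ -/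

import Mathlib

universe u v

namespace WHR

/-! ### Policies, types and expressions -/

/-- A policy is a set of clauses `Σ ⇒ a`, a clause being a pair of a lock set and an actor. -/
abbrev Policy (Actor : Type u) (Lock : Type v) := Set (Set Lock × Actor)

/-- The countably infinite set of memory locations. -/
abbrev Loc := ℕ

/-- The (unannotated) types `A`. Every component type is annotated with a policy, so `sum A₁ p₁ A₂ p₂`
is the type `A₁^p₁ + A₂^p₂`, and `arrow Σ pc A₁ p₁ A₂ p₂` is the type of functions from `A₁^p₁` to
`A₂^p₂` that require the locks in `Σ` to be open and whose effects are above `pc`. -/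
inductive Ty (Actor : Type u) (Lock : Type v) where
  | unit : Ty Actor Lock
  | nat : Ty Actor Lock
  | sum (A₁ : Ty Actor Lock) (p₁ : Policy Actor Lock) (A₂ : Ty Actor Lock) (p₂ : Policy Actor Lock) :
      Ty Actor Lock
  | prod (A₁ : Ty Actor Lock) (p₁ : Policy Actor Lock) (A₂ : Ty Actor Lock) (p₂ : Policy Actor Lock) :
      Ty Actor Lock
  | ref (A : Ty Actor Lock) (p : Policy Actor Lock) : Ty Actor Lock
  | arrow (L : Set Lock) (pc : Policy Actor Lock)
      (A₁ : Ty Actor Lock) (p₁ : Policy Actor Lock) (A₂ : Ty Actor Lock) (p₂ : Policy Actor Lock) :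
      Ty Actor Lock

/-- The annotated types `τ = A^p`. -/
structure ATy (Actor : Type u) (Lock : Type v) where
  ty : Ty Actor Lock
  pol : Policy Actor Lock

/-- Expressions up to renaming of bound variables, with de Bruijn indices: `lam` binds index `0` in its
body and `caseOf` binds index `0` in each of its two branches. -/
inductive Expr (Actor : Type u) (Lock : Type v) where
  | var (i : ℕ) : Expr Actor Lock
  | unit : Expr Actor Lock
  | nat (n : ℕ) : Expr Actor Lock
  | lam (e : Expr Actor Lock) : Expr Actor Lock
  | pair (e e' : Expr Actor Lock) : Expr Actor Lock
  | fst (e : Expr Actor Lock) : Expr Actor Lock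
  | snd (e : Expr Actor Lock) : Expr Actor Lock
  | inl (e : Expr Actor Lock) : Expr Actor Lock
  | inr (e : Expr Actor Lock) : Expr Actor Lock
  | caseOf (e e' e'' : Expr Actor Lock) : Expr Actor Lock
  | app (e e' : Expr Actor Lock) : Expr Actor Lock
  | new (e : Expr Actor Lock) (τ : ATy Actor Lock) : Expr Actor Lock
  | deref (e : Expr Actor Lock) : Expr Actor Lock
  | assign (e e' : Expr Actor Lock) : Expr Actor Lock
  | opn (σ : Lock) (e : Expr Actor Lock) : Expr Actor Lock
  | opened (σ : Lock) (e : Expr Actor Lock) : Expr Actor Lock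
  | cls (σ : Lock) (e : Expr Actor Lock) : Expr Actor Lock
  | closed (σ : Lock) (e : Expr Actor Lock) : Expr Actor Lock
  | whenOpen (σ : Lock) (e e' : Expr Actor Lock) : Expr Actor Lock
  | loc (l : Loc) : Expr Actor Lock

section

variable {Actor : Type u} {Lock : Type v}

/-- `p ⊑ q`: every clause of `q` is implied by a less restrictive clause of `p`. -/
def Policy.le (p q : Policy Actor Lock) : Prop :=
  ∀ L a, (L, a) ∈ q → ∃ L', (L', a) ∈ p ∧ L' ⊆ L

/-- The least restrictive policy. -/
def Policy.bot : Policy Actor Lock := {c | c.1 = ∅}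

def Policy.join (p q : Policy Actor Lock) : Policy Actor Lock :=
  {c | ∃ L₁ L₂, (L₁, c.2) ∈ p ∧ (L₂, c.2) ∈ q ∧ c.1 = L₁ ∪ L₂}

/-- The specialization `p[Σ]` of a policy with a set of open locks. -/
def Policy.specialize (p : Policy Actor Lock) (L : Set Lock) : Policy Actor Lock :=
  {c | ∃ L₁, (L₁, c.2) ∈ p ∧ c.1 = L₁ \ L}

/-! ### Substitution -/

/-- Lifting of a renaming under a binder. -/
def liftRen (ξ : ℕ → ℕ) : ℕ → ℕ
  | 0 => 0
  | i + 1 => ξ i + 1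

def Expr.rename : (ℕ → ℕ) → Expr Actor Lock → Expr Actor Lock
  | ξ, .var i => .var (ξ i)
  | _, .unit => .unit
  | _, .nat n => .nat n
  | ξ, .lam e => .lam (e.rename (liftRen ξ))
  | ξ, .pair e e' => .pair (e.rename ξ) (e'.rename ξ)
  | ξ, .fst e => .fst (e.rename ξ)
  | ξ, .snd e => .snd (e.rename ξ)
  | ξ, .inl e => .inl (e.rename ξ)
  | ξ, .inr e => .inr (e.rename ξ)
  | ξ, .caseOf e e' e'' =>
      .caseOf (e.rename ξ) (e'.rename (liftRen ξ)) (e''.rename (liftRen ξ))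
  | ξ, .app e e' => .app (e.rename ξ) (e'.rename ξ)
  | ξ, .new e τ => .new (e.rename ξ) τ
  | ξ, .deref e => .deref (e.rename ξ)
  | ξ, .assign e e' => .assign (e.rename ξ) (e'.rename ξ)
  | ξ, .opn σ e => .opn σ (e.rename ξ)
  | ξ, .opened σ e => .opened σ (e.rename ξ)
  | ξ, .cls σ e => .cls σ (e.rename ξ)
  | ξ, .closed σ e => .closed σ (e.rename ξ)
  | ξ, .whenOpen σ e e' => .whenOpen σ (e.rename ξ) (e'.rename ξ)
  | _, .loc l => .loc l

/-- Lifting of a simultaneous substitution under a binder. -/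
def liftSubst (γ : ℕ → Expr Actor Lock) : ℕ → Expr Actor Lock
  | 0 => .var 0
  | i + 1 => (γ i).rename Nat.succ

/-- Simultaneous capture-avoiding substitution `γ(e)`. A substitution is a total map on variables; a
partial one is extended by the identity. -/
def Expr.subst : (ℕ → Expr Actor Lock) → Expr Actor Lock → Expr Actor Lock
  | γ, .var i => γ i
  | _, .unit => .unit
  | _, .nat n => .nat n
  | γ, .lam e => .lam (e.subst (liftSubst γ))
  | γ, .pair e e' => .pair (e.subst γ) (e'.subst γ)
  | γ, .fst e => .fst (e.subst γ)
  | γ, .snd e => .snd (e.subst γ)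
  | γ, .inl e => .inl (e.subst γ)
  | γ, .inr e => .inr (e.subst γ)
  | γ, .caseOf e e' e'' =>
      .caseOf (e.subst γ) (e'.subst (liftSubst γ)) (e''.subst (liftSubst γ))
  | γ, .app e e' => .app (e.subst γ) (e'.subst γ)
  | γ, .new e τ => .new (e.subst γ) τ
  | γ, .deref e => .deref (e.subst γ)
  | γ, .assign e e' => .assign (e.subst γ) (e'.subst γ)
  | γ, .opn σ e => .opn σ (e.subst γ)
  | γ, .opened σ e => .opened σ (e.subst γ)
  | γ, .cls σ e => .cls σ (e.subst γ)
  | γ, .closed σ e => .closed σ (e.subst γ)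
  | γ, .whenOpen σ e e' => .whenOpen σ (e.subst γ) (e'.subst γ)
  | _, .loc l => .loc l

/-- The substitution of `v` for index `0` that lowers all other indices. -/
def single (v : Expr Actor Lock) : ℕ → Expr Actor Lock
  | 0 => v
  | i + 1 => .var i

/-- `[v/x]e`, where `x` is the variable with index `0` in `e`. -/
def Expr.inst (e v : Expr Actor Lock) : Expr Actor Lock := e.subst (single v)

/-! ### Operational semantics -/

inductive IsValue : Expr Actor Lock → Prop
  | unit : IsValue .unit
  | nat (n : ℕ) : IsValue (.nat n)
  | lam (e : Expr Actor Lock) : IsValue (.lam e)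
  | loc (l : Loc) : IsValue (.loc l)
  | pair {v v' : Expr Actor Lock} : IsValue v → IsValue v' → IsValue (.pair v v')
  | inl {v : Expr Actor Lock} : IsValue v → IsValue (.inl v)
  | inr {v : Expr Actor Lock} : IsValue v → IsValue (.inr v)

end

/-- States map finitely many locations to a value and to the type of the location. -/
structure State (Actor : Type u) (Lock : Type v) where
  lookup : Loc → Option (Expr Actor Lock × ATy Actor Lock)
  finite_dom : {l | lookup l ≠ none}.Finite
  isValue : ∀ l v τ, lookup l = some (v, τ) → IsValue v

/-- Observations; `eps` is the empty observation and `write l τ v` the write of `v` to the location `l`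
of type `τ`. -/
inductive Obs (Actor : Type u) (Lock : Type v) where
  | eps : Obs Actor Lock
  | write (l : Loc) (τ : ATy Actor Lock) (v : Expr Actor Lock) : Obs Actor Lock
  | opn (σ : Lock) : Obs Actor Lock
  | unopen (σ : Lock) : Obs Actor Lock
  | cls (σ : Lock) : Obs Actor Lock
  | unclose (σ : Lock) : Obs Actor Lock

/-- State environments: partial maps from locations to annotated types. -/
abbrev StateEnv (Actor : Type u) (Lock : Type v) := Loc → Option (ATy Actor Lock)

/-- An attacker: an actor together with a set of locks, its capability. -/
structure Attacker (Actor : Type u) (Lock : Type v) where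
  actor : Actor
  cap : Set Lock

section

variable {Actor : Type u} {Lock : Type v}

/-- `S[l ↦ (v, τ)]` -/
def State.set (S : State Actor Lock) (l : Loc) (v : Expr Actor Lock) (τ : ATy Actor Lock)
    (hv : IsValue v) : State Actor Lock where
  lookup := Function.update S.lookup l (some (v, τ))
  finite_dom := by
    refine (S.finite_dom.insert l).subset fun k hk => ?_
    by_cases h : k = l
    · exact Set.mem_insert_iff.2 (Or.inl h)
    · refine Set.mem_insert_of_mem _ ?_
      simpa [Function.update_of_ne h] using hk
  isValue := by
    intro k w τ' hk
    by_cases h : k = l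
    · subst h
      simp only [Function.update_self, Option.some.injEq, Prod.mk.injEq] at hk
      exact hk.1 ▸ hv
    · rw [Function.update_of_ne h] at hk
      exact S.isValue k w τ' hk

/-- `Step e L S e' S' ω L'`: with open locks `L`, the expression `e` in state `S` steps to `e'` in state
`S'` with observation `ω`, where `L'` is the active lock set, i.e. the lock set at the redex. -/
inductive Step : Expr Actor Lock → Set Lock → State Actor Lock →
    Expr Actor Lock → State Actor Lock → Obs Actor Lock → Set Lock → Prop
  | opn {σ e L S} : Step (.opn σ e) L S (.opened σ e) S (.opn σ) L
  | opened {σ e L S e' S' ω L'} : Step e (L ∪ {σ}) S e' S' ω L' →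
      Step (.opened σ e) L S (.opened σ e') S' ω L'
  | openedBeta {σ v L S} : IsValue v → Step (.opened σ v) L S v S (.unopen σ) L
  | cls {σ e L S} : Step (.cls σ e) L S (.closed σ e) S (.cls σ) L
  | closed {σ e L S e' S' ω L'} : Step e (L \ {σ}) S e' S' ω L' →
      Step (.closed σ e) L S (.closed σ e') S' ω L'
  | closedBeta {σ v L S} : IsValue v → Step (.closed σ v) L S v S (.unclose σ) L
  | deref {e L S e' S' ω L'} : Step e L S e' S' ω L' →
      Step (.deref e) L S (.deref e') S' ω L'
  | derefBeta {l L S v τ} : S.lookup l = some (v, τ) → Step (.deref (.loc l)) L S v S .eps L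
  | new {e τ L S e' S' ω L'} : Step e L S e' S' ω L' →
      Step (.new e τ) L S (.new e' τ) S' ω L'
  | newBeta {v τ L S l} (hv : IsValue v) : S.lookup l = none →
      Step (.new v τ) L S (.loc l) (S.set l v τ hv) (.write l τ v) L
  | assignL {e e' L S e'' S' ω L'} : Step e L S e'' S' ω L' →
      Step (.assign e e') L S (.assign e'' e') S' ω L'
  | assignR {l e L S e' S' ω L'} : Step e L S e' S' ω L' →
      Step (.assign (.loc l) e) L S (.assign (.loc l) e') S' ω L'
  | assignBeta {l v L S w τ} (hv : IsValue v) : S.lookup l = some (w, τ) →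
      Step (.assign (.loc l) v) L S .unit (S.set l v τ hv) (.write l τ v) L
  | appL {e e' L S e'' S' ω L'} : Step e L S e'' S' ω L' →
      Step (.app e e') L S (.app e'' e') S' ω L'
  | appR {e e' L S e'' S' ω L'} : Step e' L S e'' S' ω L' →
      Step (.app (.lam e) e') L S (.app (.lam e) e'') S' ω L'
  | appBeta {e v L S} : IsValue v → Step (.app (.lam e) v) L S (e.inst v) S .eps L
  | pairL {e e' L S e'' S' ω L'} : Step e L S e'' S' ω L' →
      Step (.pair e e') L S (.pair e'' e') S' ω L'
  | pairR {v e L S e' S' ω L'} : IsValue v → Step e L S e' S' ω L' →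
      Step (.pair v e) L S (.pair v e') S' ω L'
  | fst {e L S e' S' ω L'} : Step e L S e' S' ω L' → Step (.fst e) L S (.fst e') S' ω L'
  | fstBeta {v v' L S} : IsValue v → IsValue v' → Step (.fst (.pair v v')) L S v S .eps L
  | snd {e L S e' S' ω L'} : Step e L S e' S' ω L' → Step (.snd e) L S (.snd e') S' ω L'
  | sndBeta {v v' L S} : IsValue v → IsValue v' → Step (.snd (.pair v v')) L S v' S .eps L
  | inl {e L S e' S' ω L'} : Step e L S e' S' ω L' → Step (.inl e) L S (.inl e') S' ω L'
  | inr {e L S e' S' ω L'} : Step e L S e' S' ω L' → Step (.inr e) L S (.inr e') S' ω L'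
  | caseOf {e e' e'' L S e''' S' ω L'} : Step e L S e''' S' ω L' →
      Step (.caseOf e e' e'') L S (.caseOf e''' e' e'') S' ω L'
  | caseL {v e' e'' L S} : IsValue v →
      Step (.caseOf (.inl v) e' e'') L S (e'.inst v) S .eps L
  | caseR {v e' e'' L S} : IsValue v →
      Step (.caseOf (.inr v) e' e'') L S (e''.inst v) S .eps L
  | whenOpen {σ e e' L S e'' S' ω L'} : σ ∈ L → Step e L S e'' S' ω L' →
      Step (.whenOpen σ e e') L S (.whenOpen σ e'' e') S' ω L'
  | whenClosed {σ e e' L S e'' S' ω L'} : σ ∉ L → Step e' L S e'' S' ω L' →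
      Step (.whenOpen σ e e') L S (.whenOpen σ e e'') S' ω L'
  | whenOpenBeta {σ v e' L S} : σ ∈ L → IsValue v → Step (.whenOpen σ v e') L S v S .eps L
  | whenClosedBeta {σ e v L S} : σ ∉ L → IsValue v → Step (.whenOpen σ e v) L S v S .eps L

/-! ### The type system -/

/-- Subtyping of unannotated types; the side conditions on components say that the annotated component
types are subtypes (`SubA`). -/
inductive Sub : Ty Actor Lock → Ty Actor Lock → Prop
  | unit : Sub .unit .unit
  | nat : Sub .nat .nat
  | ref (A p) : Sub (.ref A p) (.ref A p)
  | prod {A₀ p₀ A₁ p₁ A₂ p₂ A₃ p₃} : Policy.le p₀ p₁ → Sub A₀ A₁ → Policy.le p₂ p₃ → Sub A₂ A₃ →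
      Sub (.prod A₀ p₀ A₂ p₂) (.prod A₁ p₁ A₃ p₃)
  | sum {A₀ p₀ A₁ p₁ A₂ p₂ A₃ p₃} : Policy.le p₀ p₁ → Sub A₀ A₁ → Policy.le p₂ p₃ → Sub A₂ A₃ →
      Sub (.sum A₀ p₀ A₂ p₂) (.sum A₁ p₁ A₃ p₃)
  | arrow {L L' pc pc' A₀ p₀ A₁ p₁ A₂ p₂ A₃ p₃} :
      Policy.le p₀ p₁ → Sub A₀ A₁ → Policy.le p₂ p₃ → Sub A₂ A₃ → Policy.le pc' pc → L ⊆ L' →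
      Sub (.arrow L pc A₁ p₁ A₂ p₂) (.arrow L' pc' A₀ p₀ A₃ p₃)

/-- Subtyping `τ <: τ'` of annotated types. -/
def SubA (τ τ' : ATy Actor Lock) : Prop := Policy.le τ.pol τ'.pol ∧ Sub τ.ty τ'.ty

/-- The specialization `τ[Σ]`. -/
def ATy.specialize (τ : ATy Actor Lock) (L : Set Lock) : ATy Actor Lock :=
  ⟨τ.ty, τ.pol.specialize L⟩

/-- The typing judgment `Γ; L; θ ⊢_pc e : τ`, where `lp` gives the policy of each lock and the variable
with index `i` has the type at position `i` of `Γ`. -/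
inductive HasType (lp : Lock → Policy Actor Lock) (θ : StateEnv Actor Lock) :
    List (ATy Actor Lock) → Set Lock → Policy Actor Lock → Expr Actor Lock → ATy Actor Lock → Prop
  | var {Γ L pc i τ} : Γ[i]? = some τ → HasType lp θ Γ L pc (.var i) τ
  | unit {Γ L pc} : HasType lp θ Γ L pc .unit ⟨.unit, .bot⟩
  | nat {Γ L pc} (n : ℕ) : HasType lp θ Γ L pc (.nat n) ⟨.nat, .bot⟩
  | lam {Γ L pc L' pc' e A₁ p₁ A₂ p₂} : HasType lp θ (⟨A₁, p₁⟩ :: Γ) L' pc' e ⟨A₂, p₂⟩ →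
      HasType lp θ Γ L pc (.lam e) ⟨.arrow L' pc' A₁ p₁ A₂ p₂, .bot⟩
  | opn {Γ L pc σ e τ} : HasType lp θ Γ (L ∪ {σ}) pc e τ → pc.le (lp σ) →
      HasType lp θ Γ L pc (.opn σ e) τ
  | opened {Γ L pc σ e τ} : HasType lp θ Γ (L ∪ {σ}) pc e τ → pc.le (lp σ) →
      HasType lp θ Γ L pc (.opened σ e) τ
  | cls {Γ L pc σ e τ} : HasType lp θ Γ (L \ {σ}) pc e τ → pc.le (lp σ) →
      HasType lp θ Γ L pc (.cls σ e) τ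
  | closed {Γ L pc σ e τ} : HasType lp θ Γ (L \ {σ}) pc e τ → pc.le (lp σ) →
      HasType lp θ Γ L pc (.closed σ e) τ
  | prod {Γ L pc e₁ e₂ A₁ p₁ A₂ p₂} :
      HasType lp θ Γ L pc e₁ ⟨A₁, p₁⟩ → HasType lp θ Γ L pc e₂ ⟨A₂, p₂⟩ →
      HasType lp θ Γ L pc (.pair e₁ e₂) ⟨.prod A₁ p₁ A₂ p₂, .bot⟩
  | fst {Γ L pc e A₁ p₁ A₂ p₂ p} :
      HasType lp θ Γ L pc e ⟨.prod A₁ p₁ A₂ p₂, p⟩ → p.le p₁ →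
      HasType lp θ Γ L pc (.fst e) ⟨A₁, p₁⟩
  | snd {Γ L pc e A₁ p₁ A₂ p₂ p} :
      HasType lp θ Γ L pc e ⟨.prod A₁ p₁ A₂ p₂, p⟩ → p.le p₂ →
      HasType lp θ Γ L pc (.snd e) ⟨A₂, p₂⟩
  | inl {Γ L pc e A₁ p₁ A₂ p₂} : HasType lp θ Γ L pc e ⟨A₁, p₁⟩ →
      HasType lp θ Γ L pc (.inl e) ⟨.sum A₁ p₁ A₂ p₂, .bot⟩
  | inr {Γ L pc e A₁ p₁ A₂ p₂} : HasType lp θ Γ L pc e ⟨A₂, p₂⟩ →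
      HasType lp θ Γ L pc (.inr e) ⟨.sum A₁ p₁ A₂ p₂, .bot⟩
  | caseOf {Γ L pc e e₁ e₂ A₁ p₁ A₂ p₂ p τ} :
      HasType lp θ Γ L pc e ⟨.sum A₁ p₁ A₂ p₂, p⟩ → p.le τ.pol →
      HasType lp θ (⟨A₁, p₁⟩ :: Γ) L (pc.join p) e₁ τ →
      HasType lp θ (⟨A₂, p₂⟩ :: Γ) L (pc.join p) e₂ τ →
      HasType lp θ Γ L pc (.caseOf e e₁ e₂) τ
  | sub {Γ L pc pc' e τ' τ} : HasType lp θ Γ L pc' e τ' → pc.le pc' → SubA τ' τ →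
      HasType lp θ Γ L pc e τ
  | app {Γ L pc e₁ e₂ L' pc' A₁ p₁ A₂ p₂ p τ₁'} :
      HasType lp θ Γ L pc e₁ ⟨.arrow L' pc' A₁ p₁ A₂ p₂, p⟩ →
      HasType lp θ Γ L pc e₂ τ₁' →
      p.le p₂ → (pc.join p).le pc' → SubA τ₁' ⟨A₁, p₁⟩ → L' ⊆ L →
      HasType lp θ Γ L pc (.app e₁ e₂) ⟨A₂, p₂⟩
  | deref {Γ L pc e A q p τ'} : HasType lp θ Γ L pc e ⟨.ref A q, p⟩ → p.le τ'.pol →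
      SubA ⟨A, q⟩ τ' → HasType lp θ Γ L pc (.deref e) τ'
  | new {Γ L pc e τ' τ} : HasType lp θ Γ L pc e τ' → pc.le τ.pol → SubA (τ'.specialize L) τ →
      HasType lp θ Γ L pc (.new e τ) ⟨.ref τ.ty τ.pol, .bot⟩
  | loc {Γ L pc l τ} : θ l = some τ →
      HasType lp θ Γ L pc (.loc l) ⟨.ref τ.ty τ.pol, .bot⟩
  | assign {Γ L pc e e' A' q p τ} : HasType lp θ Γ L pc e ⟨.ref A' q, p⟩ →
      SubA (τ.specialize L) ⟨A', q⟩ → HasType lp θ Γ L pc e' τ → (pc.join p).le q →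
      HasType lp θ Γ L pc (.assign e e') ⟨.unit, .bot⟩
  | whenOpen {Γ L pc σ e₁ e₂ τ} :
      HasType lp θ Γ (L ∪ {σ}) (pc.join (lp σ)) e₁ τ →
      HasType lp θ Γ L (pc.join (lp σ)) e₂ τ → (lp σ).le τ.pol →
      HasType lp θ Γ L pc (.whenOpen σ e₁ e₂) τ

/-! ### Attackers, observations and worlds -/

/-- `p ⊑ 𝒜`: data labeled `p` is visible to the attacker. -/
def Attacker.Sees (𝒜 : Attacker Actor Lock) (p : Policy Actor Lock) : Prop :=
  p.le {(𝒜.cap, 𝒜.actor)}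

/-- The policy of an observation; undefined (`none`) for the empty observation. -/
def Obs.pol (lp : Lock → Policy Actor Lock) : Obs Actor Lock → Option (Policy Actor Lock)
  | .eps => none
  | .write _ τ _ => some τ.pol
  | .opn σ => some (lp σ)
  | .unopen σ => some (lp σ)
  | .cls σ => some (lp σ)
  | .unclose σ => some (lp σ)

/-- The observation is visible to the attacker; the empty observation never is. -/
def Obs.Visible (lp : Lock → Policy Actor Lock) (𝒜 : Attacker Actor Lock) (ω : Obs Actor Lock) :
    Prop :=
  ∃ p, ω.pol lp = some p ∧ 𝒜.Sees p

/-- `L ≈_𝒜 L'`: the two lock sets contain the same attacker-visible locks. -/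
def LowEq (lp : Lock → Policy Actor Lock) (𝒜 : Attacker Actor Lock) (L L' : Set Lock) : Prop :=
  {σ | σ ∈ L ∧ 𝒜.Sees (lp σ)} = {σ | σ ∈ L' ∧ 𝒜.Sees (lp σ)}

/-- `θ ⊑ θ'`: the state environment `θ'` extends `θ`. -/
def StateEnv.Le (θ θ' : StateEnv Actor Lock) : Prop := ∀ l τ, θ l = some τ → θ' l = some τ

end

/-- Worlds: two state environments and a partial bijection between locations. -/
structure World (Actor : Type u) (Lock : Type v) where
  θ₁ : StateEnv Actor Lock
  θ₂ : StateEnv Actor Lock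
  β : Loc → Loc → Prop
  functional : ∀ l l₁ l₂, β l l₁ → β l l₂ → l₁ = l₂
  injective : ∀ l l₁ l₂, β l₁ l → β l₂ l → l₁ = l₂

section

variable {Actor : Type u} {Lock : Type v}

/-- `W ⊑ W'`: the world `W'` is a future world of `W`. -/
def World.Le (W W' : World Actor Lock) : Prop :=
  StateEnv.Le W.θ₁ W'.θ₁ ∧ StateEnv.Le W.θ₂ W'.θ₂ ∧ ∀ l l', W.β l l' → W'.β l l'

/-! ### The unary relation -/

/-- `(S, m) ▷ θ`, where `V` is the unary value relation at index `m`: all locations of `θ` are in the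
domain of `S`, with the type given by `θ`, and hold values in the value relation at that type. -/
def StateWF (V : Ty Actor Lock → Expr Actor Lock → StateEnv Actor Lock → Prop)
    (S : State Actor Lock) (θ : StateEnv Actor Lock) : Prop :=
  ∀ l τ, θ l = some τ → ∃ v, S.lookup l = some (v, τ) ∧ V τ.ty v θ

mutual

/-- The unary value relation: `UVal lp m A v θ` says `(v, θ, m) ∈ ⌊A⌋_V`. At an annotated type `A^p` it is
the relation at `A`. -/
def UVal (lp : Lock → Policy Actor Lock) (m : ℕ) :
    Ty Actor Lock → Expr Actor Lock → StateEnv Actor Lock → Prop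
  | .unit, v, _ => v = .unit
  | .nat, v, _ => ∃ n, v = .nat n
  | .prod A₁ _ A₂ _, v, θ =>
      ∃ v₁ v₂, v = .pair v₁ v₂ ∧ UVal lp m A₁ v₁ θ ∧ UVal lp m A₂ v₂ θ
  | .sum A₁ _ A₂ _, v, θ =>
      (∃ w, v = .inl w ∧ UVal lp m A₁ w θ) ∨ (∃ w, v = .inr w ∧ UVal lp m A₂ w θ)
  | .ref A p, v, θ => ∃ l, v = .loc l ∧ θ l = some ⟨A, p⟩
  | .arrow _ pc A₁ _ A₂ _, v, θ =>
      ∃ e, v = .lam e ∧ ∀ (m' : ℕ) (_ : m' < m) (θ' : StateEnv Actor Lock) (w : Expr Actor Lock),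
        StateEnv.Le θ θ' → UVal lp m' A₁ w θ' → UExp lp m' A₂ pc (e.inst w) θ'
termination_by A => (m, 0, sizeOf A)

/-- The unary expression relation: `UExp lp m A pc e θ` says `(e, θ, m) ∈ ⌊A^p⌋_E^pc` (for any `p`). -/
def UExp (lp : Lock → Policy Actor Lock) (m : ℕ) (A : Ty Actor Lock) (pc : Policy Actor Lock)
    (e : Expr Actor Lock) (θ : StateEnv Actor Lock) : Prop :=
  UVal lp m A e θ ∨
  (¬ IsValue e ∧
    ∀ (m' : ℕ) (_ : m' < m) (θ' : StateEnv Actor Lock) (S : State Actor Lock),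
      StateEnv.Le θ θ' → StateWF (fun B v ϑ => UVal lp m' B v ϑ) S θ' →
      ∀ (L : Set Lock) (e' : Expr Actor Lock) (S' : State Actor Lock) (ω : Obs Actor Lock)
        (L' : Set Lock), Step e L S e' S' ω L' →
        (ω = .eps ∨ ∃ p, ω.pol lp = some p ∧ pc.le p) ∧
        ∃ θ'' : StateEnv Actor Lock, StateEnv.Le θ' θ'' ∧
          StateWF (fun B v ϑ => UVal lp m' B v ϑ) S' θ'' ∧ UExp lp m' A pc e' θ'')
termination_by (m, 1, 0)

end

/-! ### The binary relation -/

/-- A step-indexed family of value relations, at a fixed index. -/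
abbrev ValRel (Actor : Type u) (Lock : Type v) :=
  ATy Actor Lock → Expr Actor Lock → Expr Actor Lock → World Actor Lock → Prop

/-- Indistinguishability of states `(S₁, S₂, m) ▷_𝒜 W`, where `V` is the binary value relation at index
`m` for the attacker: the states are well formed for the two state environments of the world, and matched
locations have equal types and hold related values. -/
def StateRel (lp : Lock → Policy Actor Lock) (m : ℕ) (V : ValRel Actor Lock)
    (S₁ S₂ : State Actor Lock) (W : World Actor Lock) : Prop :=
  StateWF (UVal lp m) S₁ W.θ₁ ∧ StateWF (UVal lp m) S₂ W.θ₂ ∧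
  ∀ l₁ l₂, W.β l₁ l₂ → ∃ τ v₁ v₂, W.θ₁ l₁ = some τ ∧ W.θ₂ l₂ = some τ ∧
    S₁.lookup l₁ = some (v₁, τ) ∧ S₂.lookup l₂ = some (v₂, τ) ∧ V τ v₁ v₂ W

/-- Observational indistinguishability `ω ≅_𝒜^(W, m) ω'`, where `V` is the value relation at `m`. -/
inductive ObsIndist (lp : Lock → Policy Actor Lock) (𝒜 : Attacker Actor Lock) (V : ValRel Actor Lock)
    (W : World Actor Lock) : Obs Actor Lock → Obs Actor Lock → Prop
  | high {ω ω'} : ¬ ω.Visible lp 𝒜 → ¬ ω'.Visible lp 𝒜 → ObsIndist lp 𝒜 V W ω ω'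
  | refl {ω} : (∀ l τ v, ω ≠ .write l τ v) → ObsIndist lp 𝒜 V W ω ω
  | extend {l l' τ v v'} : V τ v v' W → W.β l l' →
      ObsIndist lp 𝒜 V W (.write l τ v) (.write l' τ v')

/-- Observational irrelevance, the weaker relation used to recognize relevant declassification. -/
inductive ObsIrrel (lp : Lock → Policy Actor Lock) (𝒜 : Attacker Actor Lock) (V : ValRel Actor Lock)
    (W : World Actor Lock) : Obs Actor Lock → Obs Actor Lock → Prop
  | refl {ω} : (∀ l τ v, ω ≠ .write l τ v) → ObsIrrel lp 𝒜 V W ω ω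
  | high {ω ω'} : ¬ ω.Visible lp 𝒜 ∨ ¬ ω'.Visible lp 𝒜 → ObsIrrel lp 𝒜 V W ω ω'
  | extend {l l' τ v v'} : V τ v v' W → ObsIrrel lp 𝒜 V W (.write l τ v) (.write l' τ v')

/-- The clause for two matched steps. `V` is the value relation at the index `m`, and `E` is the
expression relation at `m` and at the type and lock sets under consideration. The steps need not be
matched after a relevant declassification, i.e. if the observations are not irrelevant and neither active
lock set is contained in the capability of the attacker. -/
def CPar (lp : Lock → Policy Actor Lock) (𝒜 : Attacker Actor Lock) (m : ℕ) (V : ValRel Actor Lock)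
    (E : Expr Actor Lock → Expr Actor Lock → World Actor Lock → Prop)
    (L₁ L₂ : Set Lock) (W : World Actor Lock) (S₁ S₂ : State Actor Lock)
    (e₁ e₂ : Expr Actor Lock) : Prop :=
  ¬ IsValue e₁ ∧ ¬ IsValue e₂ ∧
  ∀ e₁' S₁' ω L₁' e₂' S₂' ω' L₂',
    Step e₁ L₁ S₁ e₁' S₁' ω L₁' → Step e₂ L₂ S₂ e₂' S₂' ω' L₂' →
    (ObsIrrel lp 𝒜 V W ω ω' ∨ L₁' ⊆ 𝒜.cap ∨ L₂' ⊆ 𝒜.cap) →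
    ∃ W' : World Actor Lock, W.Le W' ∧ StateRel lp m V S₁' S₂' W' ∧
      ObsIndist lp 𝒜 V W' ω ω' ∧ E e₁' e₂' W'

/-- The clause for an unmatched invisible step on the left. -/
def CLeft (lp : Lock → Policy Actor Lock) (𝒜 : Attacker Actor Lock) (m : ℕ) (V : ValRel Actor Lock)
    (E : Expr Actor Lock → Expr Actor Lock → World Actor Lock → Prop)
    (L₁ : Set Lock) (W : World Actor Lock) (S₁ S₂ : State Actor Lock)
    (e₁ e₂ : Expr Actor Lock) : Prop :=
  ¬ IsValue e₁ ∧ ∀ e₁' S₁' ω L₁', Step e₁ L₁ S₁ e₁' S₁' ω L₁' → ¬ ω.Visible lp 𝒜 ∧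
    ∃ W' : World Actor Lock, W.Le W' ∧ StateRel lp m V S₁' S₂ W' ∧ E e₁' e₂ W'

/-- The clause for an unmatched invisible step on the right. -/
def CRight (lp : Lock → Policy Actor Lock) (𝒜 : Attacker Actor Lock) (m : ℕ) (V : ValRel Actor Lock)
    (E : Expr Actor Lock → Expr Actor Lock → World Actor Lock → Prop)
    (L₂ : Set Lock) (W : World Actor Lock) (S₁ S₂ : State Actor Lock)
    (e₁ e₂ : Expr Actor Lock) : Prop :=
  ¬ IsValue e₂ ∧ ∀ e₂' S₂' ω L₂', Step e₂ L₂ S₂ e₂' S₂' ω L₂' → ¬ ω.Visible lp 𝒜 ∧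
    ∃ W' : World Actor Lock, W.Le W' ∧ StateRel lp m V S₁ S₂' W' ∧ E e₁ e₂' W'

/-- The value relation at `A^p` in terms of the relation `R` at `A` (a proposition about the values under
consideration) and the two unary relations `U₁`, `U₂` at `A`. -/
def Annot (𝒜 : Attacker Actor Lock) (p : Policy Actor Lock) (R U₁ U₂ : Prop) : Prop :=
  (𝒜.Sees p ∧ R) ∨ (¬ 𝒜.Sees p ∧ U₁ ∧ U₂)

mutual

/-- The binary value relation at unannotated types: `BVal lp 𝒜 m A v v' W` says
`(v, v', W, m) ∈ ⌈A⌉_V^𝒜`. -/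
def BVal (lp : Lock → Policy Actor Lock) (𝒜 : Attacker Actor Lock) (m : ℕ) :
    Ty Actor Lock → Expr Actor Lock → Expr Actor Lock → World Actor Lock → Prop
  | .unit, v, v', _ => v = .unit ∧ v' = .unit
  | .nat, v, v', _ => ∃ n, v = .nat n ∧ v' = .nat n
  | .prod A₁ p₁ A₂ p₂, v, v', W =>
      ∃ v₁ v₂ v₁' v₂', v = .pair v₁ v₂ ∧ v' = .pair v₁' v₂' ∧
        Annot 𝒜 p₁ (BVal lp 𝒜 m A₁ v₁ v₁' W) (UVal lp m A₁ v₁ W.θ₁) (UVal lp m A₁ v₁' W.θ₂) ∧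
        Annot 𝒜 p₂ (BVal lp 𝒜 m A₂ v₂ v₂' W) (UVal lp m A₂ v₂ W.θ₁) (UVal lp m A₂ v₂' W.θ₂)
  | .sum A₁ p₁ A₂ p₂, v, v', W =>
      (∃ w w', v = .inl w ∧ v' = .inl w' ∧
        Annot 𝒜 p₁ (BVal lp 𝒜 m A₁ w w' W) (UVal lp m A₁ w W.θ₁) (UVal lp m A₁ w' W.θ₂)) ∨
      (∃ w w', v = .inr w ∧ v' = .inr w' ∧
        Annot 𝒜 p₂ (BVal lp 𝒜 m A₂ w w' W) (UVal lp m A₂ w W.θ₁) (UVal lp m A₂ w' W.θ₂))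
  | .ref A p, v, v', W =>
      ∃ l l', v = .loc l ∧ v' = .loc l' ∧
        W.θ₁ l = some ⟨A, p⟩ ∧ W.θ₂ l' = some ⟨A, p⟩ ∧ W.β l l'
  | .arrow L pc A₁ p₁ A₂ p₂, v, v', W =>
      (∃ e e', v = .lam e ∧ v' = .lam e' ∧
        ∀ (m' : ℕ) (_ : m' < m) (W' : World Actor Lock), W.Le W' →
          ∀ w w',
            Annot 𝒜 p₁ (BVal lp 𝒜 m' A₁ w w' W') (UVal lp m' A₁ w W'.θ₁) (UVal lp m' A₁ w' W'.θ₂) →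
            ∀ L₁ L₂, L ⊆ L₁ → L ⊆ L₂ → LowEq lp 𝒜 L₁ L₂ →
              BExp lp 𝒜 m' ⟨A₂, p₂⟩ (e.inst w) (e'.inst w') W' L₁ L₂) ∧
      UVal lp m (.arrow L pc A₁ p₁ A₂ p₂) v W.θ₁ ∧ UVal lp m (.arrow L pc A₁ p₁ A₂ p₂) v' W.θ₂
termination_by A => (m, 0, sizeOf A)

/-- The binary expression relation: `BExp lp 𝒜 m τ e₁ e₂ W L L'` says
`(e₁, e₂, W, L, L', m) ∈ ⌈τ⌉_E^𝒜`. -/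
def BExp (lp : Lock → Policy Actor Lock) (𝒜 : Attacker Actor Lock) (m : ℕ) (τ : ATy Actor Lock)
    (e₁ e₂ : Expr Actor Lock) (W : World Actor Lock) (L L' : Set Lock) : Prop :=
  Annot 𝒜 τ.pol (BVal lp 𝒜 m τ.ty e₁ e₂ W) (UVal lp m τ.ty e₁ W.θ₁) (UVal lp m τ.ty e₂ W.θ₂) ∨
  (LowEq lp 𝒜 L L' ∧
    ∀ L₁ L₂, L ⊆ L₁ → L' ⊆ L₂ → LowEq lp 𝒜 L₁ L₂ →
    ∀ (m' : ℕ) (_ : m' < m) (W' : World Actor Lock) (S₁ S₂ : State Actor Lock), W.Le W' →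
      StateRel lp m' (fun τ' v v' W₀ => Annot 𝒜 τ'.pol (BVal lp 𝒜 m' τ'.ty v v' W₀)
        (UVal lp m' τ'.ty v W₀.θ₁) (UVal lp m' τ'.ty v' W₀.θ₂)) S₁ S₂ W' →
      (CPar lp 𝒜 m' (fun τ' v v' W₀ => Annot 𝒜 τ'.pol (BVal lp 𝒜 m' τ'.ty v v' W₀)
          (UVal lp m' τ'.ty v W₀.θ₁) (UVal lp m' τ'.ty v' W₀.θ₂))
          (fun e e' W₀ => BExp lp 𝒜 m' τ e e' W₀ L L') L₁ L₂ W' S₁ S₂ e₁ e₂ ∨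
       CLeft lp 𝒜 m' (fun τ' v v' W₀ => Annot 𝒜 τ'.pol (BVal lp 𝒜 m' τ'.ty v v' W₀)
          (UVal lp m' τ'.ty v W₀.θ₁) (UVal lp m' τ'.ty v' W₀.θ₂))
          (fun e e' W₀ => BExp lp 𝒜 m' τ e e' W₀ L L') L₁ W' S₁ S₂ e₁ e₂ ∨
       CRight lp 𝒜 m' (fun τ' v v' W₀ => Annot 𝒜 τ'.pol (BVal lp 𝒜 m' τ'.ty v v' W₀)
          (UVal lp m' τ'.ty v W₀.θ₁) (UVal lp m' τ'.ty v' W₀.θ₂))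
          (fun e e' W₀ => BExp lp 𝒜 m' τ e e' W₀ L L') L₂ W' S₁ S₂ e₁ e₂))
termination_by (m, 1, 0)

end

/-- The binary value relation at annotated types: `(v, v', W, m) ∈ ⌈τ⌉_V^𝒜`. -/
def BValA (lp : Lock → Policy Actor Lock) (𝒜 : Attacker Actor Lock) (m : ℕ) : ValRel Actor Lock :=
  fun τ v v' W => Annot 𝒜 τ.pol (BVal lp 𝒜 m τ.ty v v' W)
    (UVal lp m τ.ty v W.θ₁) (UVal lp m τ.ty v' W.θ₂)

/-- `(γ, W, m) ∈ ⌈Γ⌉_V^𝒜` for the binary substitution `γ = (γ₁, γ₂)`. -/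
def BSubst (lp : Lock → Policy Actor Lock) (𝒜 : Attacker Actor Lock) (m : ℕ)
    (Γ : List (ATy Actor Lock)) (γ₁ γ₂ : ℕ → Expr Actor Lock) (W : World Actor Lock) : Prop :=
  ∀ i τ, Γ[i]? = some τ → BValA lp 𝒜 m τ (γ₁ i) (γ₂ i) W

end

end WHR

/-!
The theorem is the fundamental theorem of a step-indexed logical relation, and is proved by induction on
the typing derivation, with one compatibility lemma for each typing rule.

All compatibility lemmas follow one pattern. A subterm in evaluation position is reduced to a value by a
bind lemma (`UExp.bind`, `BExp.bind`), which holds for every evaluation frame (`IsFrame`) and is proved by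
induction on the step index; a frame may change the open locks, as long as it does so monotonically and
preserves agreement on the visible locks. What remains is a redex, most often a pure one (`PureRedex`), for
which the two runs take the same step.

The runs cannot be kept synchronized when an invisible value or lock decides how they continue: a scrutinee,
a function, or the lock of a `when`. The type system then makes the effects and the result of the
continuation invisible. By the unary fundamental theorem (`HasType.uExp`) each continuation is well behaved
on its own, and `BExp.of_not_sees` shows that any two such expressions are related: a step of one of them
leaves all locations of a visible type unchanged, so it can be taken unmatched. This argument
uses that the binary value relation is contained in the unary one (`BVal.unary`), which also yields
subtyping, as raising a policy may make a value invisible (`binary_sub`).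

Declassification enters only at writes (`BExp.new`, `BExp.assign`), where the type of the value is
specialized with the open locks. If the two writes have to be matched and are visible, then either they are
assumed to carry related values, or the active locks are within the capability of the attacker and the values
are related because their type was visible before the specialization (`BValA.of_write`).
-/

namespace WHR

section

variable {Actor : Type u} {Lock : Type v}

/-! ### Policies and subtyping -/

theorem Policy.le_refl (p : Policy Actor Lock) : p.le p := fun L _ h => ⟨L, h, subset_rfl⟩

theorem Policy.le_trans {p q r : Policy Actor Lock} (h : p.le q) (h' : q.le r) : p.le r := by
  intro L a hr
  obtain ⟨L', hq, hL'⟩ := h' L a hr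
  obtain ⟨L'', hp, hL''⟩ := h L' a hq
  exact ⟨L'', hp, hL''.trans hL'⟩

theorem Policy.le_join_left (p q : Policy Actor Lock) : p.le (p.join q) := by
  rintro L a ⟨L₁, L₂, h₁, -, rfl : L = _⟩
  exact ⟨L₁, h₁, Set.subset_union_left⟩

theorem Policy.le_join_right (p q : Policy Actor Lock) : q.le (p.join q) := by
  rintro L a ⟨L₁, L₂, -, h₂, rfl : L = _⟩
  exact ⟨L₂, h₂, Set.subset_union_right⟩

theorem Sub.refl : ∀ A : Ty Actor Lock, Sub A A
  | .unit => .unit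
  | .nat => .nat
  | .ref A p => .ref A p
  | .sum A₁ p₁ A₂ p₂ => .sum p₁.le_refl (Sub.refl A₁) p₂.le_refl (Sub.refl A₂)
  | .prod A₁ p₁ A₂ p₂ => .prod p₁.le_refl (Sub.refl A₁) p₂.le_refl (Sub.refl A₂)
  | .arrow _ pc A₁ p₁ A₂ p₂ =>
      .arrow p₁.le_refl (Sub.refl A₁) p₂.le_refl (Sub.refl A₂) pc.le_refl subset_rfl

theorem SubA.refl (τ : ATy Actor Lock) : SubA τ τ := ⟨τ.pol.le_refl, Sub.refl τ.ty⟩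

theorem StateEnv.Le.refl (θ : StateEnv Actor Lock) : StateEnv.Le θ θ := fun _ _ h => h

theorem StateEnv.Le.trans {θ θ' θ'' : StateEnv Actor Lock} (h : StateEnv.Le θ θ')
    (h' : StateEnv.Le θ' θ'') : StateEnv.Le θ θ'' := fun l τ hl => h' l τ (h l τ hl)

theorem StateEnv.Le.update {θ : StateEnv Actor Lock} {l : Loc} (h : θ l = none)
    (τ : ATy Actor Lock) : StateEnv.Le θ (Function.update θ l (some τ)) := by
  intro k τ' hk
  have hkl : k ≠ l := by rintro rfl; simp [h] at hk
  rwa [Function.update_of_ne hkl]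

/-! ### Substitution -/

/-- The substitution that maps index `0` to `v` and index `i + 1` to `γ i`. -/
def consSubst (v : Expr Actor Lock) (γ : ℕ → Expr Actor Lock) : ℕ → Expr Actor Lock
  | 0 => v
  | i + 1 => γ i

theorem Expr.rename_rename (e : Expr Actor Lock) (ξ ζ : ℕ → ℕ) :
    (e.rename ξ).rename ζ = e.rename (ζ ∘ ξ) := by
  have lift : ∀ ξ ζ : ℕ → ℕ, liftRen ζ ∘ liftRen ξ = liftRen (ζ ∘ ξ) := by
    intro ξ ζ; funext i; cases i <;> rfl
  induction e generalizing ξ ζ <;> simp_all [Expr.rename]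

theorem Expr.subst_of_rename (e : Expr Actor Lock) (ξ : ℕ → ℕ) (γ : ℕ → Expr Actor Lock) :
    (e.rename ξ).subst γ = e.subst (γ ∘ ξ) := by
  have lift : ∀ (ξ : ℕ → ℕ) (γ : ℕ → Expr Actor Lock),
      liftSubst γ ∘ liftRen ξ = liftSubst (γ ∘ ξ) := by
    intro ξ γ; funext i; cases i <;> rfl
  induction e generalizing ξ γ <;> simp_all [Expr.rename, Expr.subst]

theorem Expr.rename_of_subst (e : Expr Actor Lock) (γ : ℕ → Expr Actor Lock) (ξ : ℕ → ℕ) :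
    (e.subst γ).rename ξ = e.subst (fun i => (γ i).rename ξ) := by
  have lift : ∀ (ξ : ℕ → ℕ) (γ : ℕ → Expr Actor Lock),
      (fun i => (liftSubst γ i).rename (liftRen ξ)) = liftSubst (fun i => (γ i).rename ξ) := by
    intro ξ γ; funext i
    cases i with
    | zero => rfl
    | succ i => simp only [liftSubst, Expr.rename_rename]; rfl
  induction e generalizing ξ γ <;> simp_all [Expr.rename, Expr.subst]

theorem Expr.subst_subst (e : Expr Actor Lock) (γ δ : ℕ → Expr Actor Lock) :
    (e.subst γ).subst δ = e.subst (fun i => (γ i).subst δ) := by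
  have lift : ∀ γ δ : ℕ → Expr Actor Lock,
      (fun i => (liftSubst γ i).subst (liftSubst δ)) = liftSubst (fun i => (γ i).subst δ) := by
    intro γ δ; funext i
    cases i with
    | zero => rfl
    | succ i => simp only [liftSubst, Expr.subst_of_rename, Expr.rename_of_subst]; rfl
  induction e generalizing γ δ <;> simp_all [Expr.subst]

theorem Expr.subst_var (e : Expr Actor Lock) : e.subst .var = e := by
  have lift : liftSubst (.var : ℕ → Expr Actor Lock) = .var := by
    funext i; cases i <;> rfl
  induction e <;> simp_all [Expr.subst]

theorem Expr.inst_subst (e v : Expr Actor Lock) (γ : ℕ → Expr Actor Lock) :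
    (e.subst (liftSubst γ)).inst v = e.subst (consSubst v γ) := by
  rw [Expr.inst, Expr.subst_subst]
  congr 1
  funext i
  cases i with
  | zero => rfl
  | succ i =>
    simp only [liftSubst, Expr.subst_of_rename, consSubst]
    exact (γ i).subst_var

/-! ### Reduction steps and evaluation frames -/

theorem IsValue.not_step {v : Expr Actor Lock} (hv : IsValue v) {L S e' S' ω L'} :
    ¬ Step v L S e' S' ω L' := by
  induction hv generalizing L S e' S' ω L' with
  | unit | nat | lam | loc => intro h; cases h
  | pair _ _ ih ih' =>
    intro h
    cases h with
    | pairL h => exact ih h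
    | pairR _ h => exact ih' h
  | inl _ ih => intro h; cases h with | inl h => exact ih h
  | inr _ ih => intro h; cases h with | inr h => exact ih h

theorem State.lookup_set_self (S : State Actor Lock) (l v τ hv) :
    (S.set l v τ hv).lookup l = some (v, τ) := Function.update_self ..

theorem State.lookup_set_of_ne (S : State Actor Lock) {l k : Loc} (v τ hv) (h : k ≠ l) :
    (S.set l v τ hv).lookup k = S.lookup k := Function.update_of_ne h ..

/-- A step changes the contents of an allocated location only by an observed write to it, which keeps
the type of the location. -/
theorem Step.lookup {e L S e' S' ω L'} (h : Step (Actor := Actor) (Lock := Lock) e L S e' S' ω L')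
    {l v τ} (hl : S.lookup l = some (v, τ)) :
    S'.lookup l = some (v, τ) ∨ ∃ w, ω = .write l τ w := by
  induction h with
  | opn | openedBeta | cls | closedBeta | derefBeta | appBeta | fstBeta | sndBeta | caseL | caseR
  | whenOpenBeta | whenClosedBeta => exact Or.inl hl
  | newBeta hv hk =>
    refine Or.inl ?_
    rwa [State.lookup_set_of_ne]
    rintro rfl
    simp [hl] at hk
  | @assignBeta k v L S w τ' hv hk =>
    by_cases hlk : l = k
    · subst hlk
      obtain ⟨-, rfl⟩ := Prod.mk.inj (Option.some.inj (hl.symm.trans hk))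
      exact Or.inr ⟨_, rfl⟩
    · exact Or.inl (by rwa [State.lookup_set_of_ne _ _ _ _ hlk])
  | _ => rename_i ih; exact ih hl

/-- `K` is an evaluation frame that reduces its argument with the open locks `f L` when the open locks
are `L`. -/
structure IsFrame (f : Set Lock → Set Lock) (K : Expr Actor Lock → Expr Actor Lock) : Prop where
  not_value : ∀ e, ¬ IsValue e → ¬ IsValue (K e)
  step_inv : ∀ {e L S r S' ω L'}, ¬ IsValue e → Step (K e) L S r S' ω L' →
    ∃ e', r = K e' ∧ Step e (f L) S e' S' ω L'
  mono : Monotone f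
  mem_congr : ∀ {σ L₁ L₂}, (σ ∈ L₁ ↔ σ ∈ L₂) → (σ ∈ f L₁ ↔ σ ∈ f L₂)

theorem IsFrame.of_id {K : Expr Actor Lock → Expr Actor Lock}
    (h : ∀ e, ¬ IsValue e → ¬ IsValue (K e))
    (h' : ∀ {e L S r S' ω L'}, ¬ IsValue e → Step (K e) L S r S' ω L' →
      ∃ e', r = K e' ∧ Step e L S e' S' ω L') : IsFrame id K :=
  ⟨h, h', monotone_id, id⟩

theorem IsFrame.opened (σ : Lock) : IsFrame (· ∪ {σ}) (Expr.opened (Actor := Actor) σ) where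
  not_value _ _ := nofun
  step_inv hv h := by
    cases h with
    | opened h => exact ⟨_, rfl, h⟩
    | openedBeta h => exact absurd h hv
  mono _ _ h := Set.union_subset_union_left _ h
  mem_congr h := or_congr_left h

theorem IsFrame.closed (σ : Lock) : IsFrame (· \ {σ}) (Expr.closed (Actor := Actor) σ) where
  not_value _ _ := nofun
  step_inv hv h := by
    cases h with
    | closed h => exact ⟨_, rfl, h⟩
    | closedBeta h => exact absurd h hv
  mono _ _ h := Set.sdiff_subset_sdiff_left h
  mem_congr h := and_congr_left' h

theorem IsFrame.deref : IsFrame id (Expr.deref (Actor := Actor) (Lock := Lock)) := by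
  refine .of_id (fun _ _ => nofun) fun hv h => ?_
  cases h with
  | deref h => exact ⟨_, rfl, h⟩
  | derefBeta => exact absurd (.loc _) hv

theorem IsFrame.new (τ : ATy Actor Lock) : IsFrame id (Expr.new · τ) := by
  refine .of_id (fun _ _ => nofun) fun hv h => ?_
  cases h with
  | new h => exact ⟨_, rfl, h⟩
  | newBeta h => exact absurd h hv

theorem IsFrame.assignL (e' : Expr Actor Lock) : IsFrame id (Expr.assign · e') := by
  refine .of_id (fun _ _ => nofun) fun hv h => ?_
  cases h with
  | assignL h => exact ⟨_, rfl, h⟩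
  | assignR | assignBeta => exact absurd (.loc _) hv

theorem IsFrame.assignR (l : Loc) :
    IsFrame id (Expr.assign (.loc l : Expr Actor Lock)) := by
  refine .of_id (fun _ _ => nofun) fun hv h => ?_
  cases h with
  | assignL h => cases h
  | assignR h => exact ⟨_, rfl, h⟩
  | assignBeta h => exact absurd h hv

theorem IsFrame.appL (e' : Expr Actor Lock) : IsFrame id (Expr.app · e') := by
  refine .of_id (fun _ _ => nofun) fun hv h => ?_
  cases h with
  | appL h => exact ⟨_, rfl, h⟩
  | appR | appBeta => exact absurd (.lam _) hv

theorem IsFrame.appR (b : Expr Actor Lock) : IsFrame id (Expr.app (.lam b)) := by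
  refine .of_id (fun _ _ => nofun) fun hv h => ?_
  cases h with
  | appL h => cases h
  | appR h => exact ⟨_, rfl, h⟩
  | appBeta h => exact absurd h hv

theorem IsFrame.pairL (e' : Expr Actor Lock) : IsFrame id (Expr.pair · e') := by
  refine .of_id (fun _ hv h => ?_) fun hv h => ?_
  · cases h with | pair h _ => exact hv h
  · cases h with
    | pairL h => exact ⟨_, rfl, h⟩
    | pairR h => exact absurd h hv

theorem IsFrame.pairR {v : Expr Actor Lock} (hv : IsValue v) : IsFrame id (Expr.pair v) := by
  refine .of_id (fun _ hv h => ?_) fun _ h => ?_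
  · cases h with | pair _ h => exact hv h
  · cases h with
    | pairL h => exact absurd h hv.not_step
    | pairR _ h => exact ⟨_, rfl, h⟩

theorem IsFrame.fst : IsFrame id (Expr.fst (Actor := Actor) (Lock := Lock)) := by
  refine .of_id (fun _ _ => nofun) fun hv h => ?_
  cases h with
  | fst h => exact ⟨_, rfl, h⟩
  | fstBeta h h' => exact absurd (.pair h h') hv

theorem IsFrame.snd : IsFrame id (Expr.snd (Actor := Actor) (Lock := Lock)) := by
  refine .of_id (fun _ _ => nofun) fun hv h => ?_
  cases h with
  | snd h => exact ⟨_, rfl, h⟩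
  | sndBeta h h' => exact absurd (.pair h h') hv

theorem IsFrame.inl : IsFrame id (Expr.inl (Actor := Actor) (Lock := Lock)) := by
  refine .of_id (fun _ hv h => ?_) fun hv h => ?_
  · cases h with | inl h => exact hv h
  · cases h with | inl h => exact ⟨_, rfl, h⟩

theorem IsFrame.inr : IsFrame id (Expr.inr (Actor := Actor) (Lock := Lock)) := by
  refine .of_id (fun _ hv h => ?_) fun hv h => ?_
  · cases h with | inr h => exact hv h
  · cases h with | inr h => exact ⟨_, rfl, h⟩

theorem IsFrame.caseOf (e' e'' : Expr Actor Lock) : IsFrame id (Expr.caseOf · e' e'') := by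
  refine .of_id (fun _ _ => nofun) fun hv h => ?_
  cases h with
  | caseOf h => exact ⟨_, rfl, h⟩
  | caseL h => exact absurd (.inl h) hv
  | caseR h => exact absurd (.inr h) hv

/-- The non-value `e` steps at most to `r`, with observation `ω`, which is not a write, and without
changing the state. -/
structure PureRedex (e : Expr Actor Lock) (ω : Obs Actor Lock) (r : Expr Actor Lock) : Prop where
  not_value : ¬ IsValue e
  not_write : ∀ l τ v, ω ≠ .write l τ v
  step_inv : ∀ {L S r' S' ω' L'}, Step e L S r' S' ω' L' → r' = r ∧ S' = S ∧ ω' = ω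

theorem PureRedex.opn (σ : Lock) (e : Expr Actor Lock) :
    PureRedex (.opn σ e) (.opn σ) (.opened σ e) :=
  ⟨nofun, nofun, fun h => by cases h; exact ⟨rfl, rfl, rfl⟩⟩

theorem PureRedex.cls (σ : Lock) (e : Expr Actor Lock) :
    PureRedex (.cls σ e) (.cls σ) (.closed σ e) :=
  ⟨nofun, nofun, fun h => by cases h; exact ⟨rfl, rfl, rfl⟩⟩

theorem PureRedex.opened (σ : Lock) {v : Expr Actor Lock} (hv : IsValue v) :
    PureRedex (.opened σ v) (.unopen σ) v := by
  refine ⟨nofun, nofun, fun h => ?_⟩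
  cases h with
  | opened h => exact absurd h hv.not_step
  | openedBeta => exact ⟨rfl, rfl, rfl⟩

theorem PureRedex.closed (σ : Lock) {v : Expr Actor Lock} (hv : IsValue v) :
    PureRedex (.closed σ v) (.unclose σ) v := by
  refine ⟨nofun, nofun, fun h => ?_⟩
  cases h with
  | closed h => exact absurd h hv.not_step
  | closedBeta => exact ⟨rfl, rfl, rfl⟩

theorem PureRedex.app (b : Expr Actor Lock) {v : Expr Actor Lock} (hv : IsValue v) :
    PureRedex (.app (.lam b) v) .eps (b.inst v) := by
  refine ⟨nofun, nofun, fun h => ?_⟩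
  cases h with
  | appL h => cases h
  | appR h => exact absurd h hv.not_step
  | appBeta => exact ⟨rfl, rfl, rfl⟩

theorem PureRedex.fst {v v' : Expr Actor Lock} (hv : IsValue v) (hv' : IsValue v') :
    PureRedex (.fst (.pair v v')) .eps v := by
  refine ⟨nofun, nofun, fun h => ?_⟩
  cases h with
  | fst h => exact absurd h (IsValue.pair hv hv').not_step
  | fstBeta => exact ⟨rfl, rfl, rfl⟩

theorem PureRedex.snd {v v' : Expr Actor Lock} (hv : IsValue v) (hv' : IsValue v') :
    PureRedex (.snd (.pair v v')) .eps v' := by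
  refine ⟨nofun, nofun, fun h => ?_⟩
  cases h with
  | snd h => exact absurd h (IsValue.pair hv hv').not_step
  | sndBeta => exact ⟨rfl, rfl, rfl⟩

theorem PureRedex.caseL {v : Expr Actor Lock} (hv : IsValue v) (e' e'' : Expr Actor Lock) :
    PureRedex (.caseOf (.inl v) e' e'') .eps (e'.inst v) := by
  refine ⟨nofun, nofun, fun h => ?_⟩
  cases h with
  | caseOf h => exact absurd h hv.inl.not_step
  | caseL => exact ⟨rfl, rfl, rfl⟩

theorem PureRedex.caseR {v : Expr Actor Lock} (hv : IsValue v) (e' e'' : Expr Actor Lock) :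
    PureRedex (.caseOf (.inr v) e' e'') .eps (e''.inst v) := by
  refine ⟨nofun, nofun, fun h => ?_⟩
  cases h with
  | caseOf h => exact absurd h hv.inr.not_step
  | caseR => exact ⟨rfl, rfl, rfl⟩

end

section

variable {Actor : Type u} {Lock : Type v}
variable {lp : Lock → Policy Actor Lock} {m m' : ℕ}
variable {A B A₁ A₂ : Ty Actor Lock} {p p₁ p₂ q pc pc' : Policy Actor Lock} {τ : ATy Actor Lock}
variable {e e' e₁ e₂ v : Expr Actor Lock} {θ θ' : StateEnv Actor Lock}

/-! ### The unary relation -/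

theorem UExp_iff : UExp lp m A pc e θ ↔ UVal lp m A e θ ∨
    (¬ IsValue e ∧
      ∀ m' < m, ∀ (θ' : StateEnv Actor Lock) (S : State Actor Lock),
        StateEnv.Le θ θ' → StateWF (UVal lp m') S θ' →
        ∀ (L : Set Lock) (e' : Expr Actor Lock) (S' : State Actor Lock) (ω : Obs Actor Lock)
          (L' : Set Lock), Step e L S e' S' ω L' →
          (ω = .eps ∨ ∃ p, ω.pol lp = some p ∧ pc.le p) ∧
          ∃ θ'' : StateEnv Actor Lock, StateEnv.Le θ' θ'' ∧
            StateWF (UVal lp m') S' θ'' ∧ UExp lp m' A pc e' θ'') := by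
  rw [UExp]

theorem UVal.isValue (h : UVal lp m A v θ) : IsValue v := by
  induction A generalizing v with
  | unit => simp only [UVal] at h; exact h ▸ .unit
  | nat => simp only [UVal] at h; obtain ⟨n, rfl⟩ := h; exact .nat n
  | sum A₁ p₁ A₂ p₂ ih₁ ih₂ =>
    simp only [UVal] at h
    obtain ⟨w, rfl, h⟩ | ⟨w, rfl, h⟩ := h
    · exact .inl (ih₁ h)
    · exact .inr (ih₂ h)
  | prod A₁ p₁ A₂ p₂ ih₁ ih₂ =>
    simp only [UVal] at h
    obtain ⟨w, w', rfl, h, h'⟩ := h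
    exact .pair (ih₁ h) (ih₂ h')
  | ref A p => simp only [UVal] at h; obtain ⟨l, rfl, -⟩ := h; exact .loc l
  | arrow => simp only [UVal] at h; obtain ⟨e, rfl, -⟩ := h; exact .lam e

theorem UVal.mono (h : UVal lp m A v θ) (hm : m' ≤ m) (hθ : StateEnv.Le θ θ') :
    UVal lp m' A v θ' := by
  induction A generalizing v with
  | unit | nat => simpa only [UVal] using h
  | sum A₁ p₁ A₂ p₂ ih₁ ih₂ =>
    simp only [UVal] at h ⊢
    exact h.imp (fun ⟨w, hw, h⟩ => ⟨w, hw, ih₁ h⟩) (fun ⟨w, hw, h⟩ => ⟨w, hw, ih₂ h⟩)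
  | prod A₁ p₁ A₂ p₂ ih₁ ih₂ =>
    simp only [UVal] at h ⊢
    obtain ⟨w, w', hv, h, h'⟩ := h
    exact ⟨w, w', hv, ih₁ h, ih₂ h'⟩
  | ref A p =>
    simp only [UVal] at h ⊢
    obtain ⟨l, hv, h⟩ := h
    exact ⟨l, hv, hθ _ _ h⟩
  | arrow =>
    simp only [UVal] at h ⊢
    obtain ⟨e, hv, h⟩ := h
    exact ⟨e, hv, fun n hn ϑ w hϑ => h n (hn.trans_le hm) ϑ w (hθ.trans hϑ)⟩

theorem UExp.mono (h : UExp lp m A pc e θ) (hm : m' ≤ m) (hθ : StateEnv.Le θ θ') :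
    UExp lp m' A pc e θ' := by
  rw [UExp_iff] at h ⊢
  exact h.imp (·.mono hm hθ) fun ⟨hv, h⟩ =>
    ⟨hv, fun n hn ϑ S hϑ => h n (hn.trans_le hm) ϑ S (hθ.trans hϑ)⟩

theorem UVal.uExp (h : UVal lp m A v θ) : UExp lp m A pc v θ := UExp_iff.2 (.inl h)

/-- The two subtyping statements, for values and for expressions, by simultaneous induction on the step
index: a function type refers to the relations at smaller indices. -/
theorem unary_sub (m : ℕ) :
    (∀ {A B : Ty Actor Lock} {v θ}, Sub A B → UVal lp m A v θ → UVal lp m B v θ) ∧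
    (∀ {A B : Ty Actor Lock} {pc pc' e θ}, Sub A B → Policy.le pc' pc → UExp lp m A pc e θ →
      UExp lp m B pc' e θ) := by
  induction m using Nat.strong_induction_on with
  | _ m ih =>
    have hV : ∀ {A B : Ty Actor Lock} {v θ}, Sub A B → UVal lp m A v θ → UVal lp m B v θ := by
      intro A B v θ hAB
      induction hAB generalizing v with
      | unit | nat | ref => exact id
      | prod _ _ _ _ ih₁ ih₂ =>
        simp only [UVal]
        rintro ⟨w, w', hv, h, h'⟩
        exact ⟨w, w', hv, ih₁ h, ih₂ h'⟩
      | sum _ _ _ _ ih₁ ih₂ =>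
        simp only [UVal]
        exact Or.imp (fun ⟨w, hw, h⟩ => ⟨w, hw, ih₁ h⟩) (fun ⟨w, hw, h⟩ => ⟨w, hw, ih₂ h⟩)
      | arrow _ h₁ _ h₂ hpc =>
        simp only [UVal]
        rintro ⟨e, hv, h⟩
        exact ⟨e, hv, fun n hn ϑ w hϑ hw =>
          (ih n hn).2 h₂ hpc (h n hn ϑ w hϑ ((ih n hn).1 h₁ hw))⟩
    refine ⟨hV, fun hAB hpc h => ?_⟩
    rw [UExp_iff] at h ⊢
    refine h.imp (hV hAB) fun ⟨hv, h⟩ => ⟨hv, fun n hn ϑ S hϑ hS L e' S' ω L' he => ?_⟩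
    obtain ⟨hω, θ'', hθ'', hS', he'⟩ := h n hn ϑ S hϑ hS L e' S' ω L' he
    exact ⟨hω.imp_right fun ⟨p, hp, hle⟩ => ⟨p, hp, Policy.le_trans hpc hle⟩, θ'', hθ'', hS',
      (ih n hn).2 hAB hpc he'⟩

theorem UVal.sub (h : UVal lp m A v θ) (hAB : Sub A B) : UVal lp m B v θ := (unary_sub m).1 hAB h

theorem UExp.sub (h : UExp lp m A pc e θ) (hAB : Sub A B) (hpc : pc'.le pc) :
    UExp lp m B pc' e θ := (unary_sub m).2 hAB hpc h

theorem UExp.le_pc (h : UExp lp m A pc e θ) (hpc : pc'.le pc) : UExp lp m A pc' e θ :=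
  h.sub (Sub.refl A) hpc

/-- To relate `K e`, it is enough to relate `K v` for the values `v` that `e` may reduce to. -/
theorem UExp.bind {f : Set Lock → Set Lock} {K : Expr Actor Lock → Expr Actor Lock}
    (hK : IsFrame f K) (h : UExp lp m A pc e θ)
    (hv : ∀ n ≤ m, ∀ ϑ v, StateEnv.Le θ ϑ → UVal lp n A v ϑ → UExp lp n B pc (K v) ϑ) :
    UExp lp m B pc (K e) θ := by
  induction m using Nat.strong_induction_on generalizing e θ with
  | _ m ih =>
    obtain h | ⟨he, h⟩ := UExp_iff.1 h
    · exact hv m le_rfl θ e (.refl θ) h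
    · refine UExp_iff.2 (.inr ⟨hK.not_value e he, fun n hn ϑ S hϑ hS L r S' ω L' hr => ?_⟩)
      obtain ⟨e', rfl, he'⟩ := hK.step_inv he hr
      obtain ⟨hω, θ'', hθ'', hS', he''⟩ := h n hn ϑ S hϑ hS _ e' S' ω L' he'
      exact ⟨hω, θ'', hθ'', hS', ih n hn he'' fun k hk ϑ' v hϑ' =>
        hv k (hk.trans hn.le) ϑ' v ((hϑ.trans hθ'').trans hϑ')⟩

theorem UExp.of_pureRedex {ω : Obs Actor Lock} (he : PureRedex e ω e')
    (hω : ω = .eps ∨ ∃ p, ω.pol lp = some p ∧ pc.le p)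
    (h : ∀ n < m, UExp lp n A pc e' θ) : UExp lp m A pc e θ := by
  refine UExp_iff.2 (.inr ⟨he.not_value, fun n hn ϑ S hϑ hS L r S' ω L' hr => ?_⟩)
  obtain ⟨rfl, rfl, rfl⟩ := he.step_inv hr
  exact ⟨hω, ϑ, .refl ϑ, hS, (h n hn).mono le_rfl hϑ⟩

theorem StateWF.set {S : State Actor Lock} {l : Loc} (h : StateWF (UVal lp m) S θ)
    (hθ : StateEnv.Le θ θ') (hne : ∀ k ≠ l, θ' k = θ k) (hl : θ' l = some τ) (hv : IsValue v)
    (hu : UVal lp m τ.ty v θ') : StateWF (UVal lp m) (S.set l v τ hv) θ' := by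
  intro k τ' hk
  by_cases hkl : k = l
  · subst hkl
    obtain rfl : τ = τ' := Option.some.inj (hl.symm.trans hk)
    exact ⟨v, S.lookup_set_self .., hu⟩
  · rw [hne k hkl] at hk
    obtain ⟨w, hw, hwu⟩ := h k τ' hk
    exact ⟨w, by rwa [S.lookup_set_of_ne _ _ _ hkl], hwu.mono le_rfl hθ⟩

theorem StateWF.env_eq_none {V : Ty Actor Lock → Expr Actor Lock → StateEnv Actor Lock → Prop}
    {S : State Actor Lock} {l : Loc} (h : StateWF V S θ) (hl : S.lookup l = none) : θ l = none := by
  by_contra hne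
  obtain ⟨τ, hτ⟩ := Option.ne_none_iff_exists'.1 hne
  obtain ⟨v, hv, -⟩ := h l τ hτ
  simp [hl] at hv

theorem StateWF.eq_of_lookup {V : Ty Actor Lock → Expr Actor Lock → StateEnv Actor Lock → Prop}
    {S : State Actor Lock} {l : Loc} {τ' : ATy Actor Lock} (h : StateWF V S θ)
    (hθ : θ l = some τ) (hl : S.lookup l = some (v, τ')) : τ' = τ ∧ V τ.ty v θ := by
  obtain ⟨w, hw, hV⟩ := h l τ hθ
  obtain ⟨rfl, rfl⟩ := Prod.mk.inj (Option.some.inj (hl.symm.trans hw))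
  exact ⟨rfl, hV⟩

theorem UExp.opened {σ : Lock} (h : UExp lp m A pc e θ) (hpc : pc.le (lp σ)) :
    UExp lp m A pc (.opened σ e) θ :=
  h.bind (.opened σ) fun _ _ _ _ _ hv => .of_pureRedex (.opened σ hv.isValue) (.inr ⟨_, rfl, hpc⟩)
    fun _ hn => (hv.mono hn.le (.refl _)).uExp

theorem UExp.opn {σ : Lock} (h : UExp lp m A pc e θ) (hpc : pc.le (lp σ)) :
    UExp lp m A pc (.opn σ e) θ :=
  .of_pureRedex (.opn σ e) (.inr ⟨_, rfl, hpc⟩) fun _ hn => (h.mono hn.le (.refl _)).opened hpc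

theorem UExp.closed {σ : Lock} (h : UExp lp m A pc e θ) (hpc : pc.le (lp σ)) :
    UExp lp m A pc (.closed σ e) θ :=
  h.bind (.closed σ) fun _ _ _ _ _ hv => .of_pureRedex (.closed σ hv.isValue) (.inr ⟨_, rfl, hpc⟩)
    fun _ hn => (hv.mono hn.le (.refl _)).uExp

theorem UExp.cls {σ : Lock} (h : UExp lp m A pc e θ) (hpc : pc.le (lp σ)) :
    UExp lp m A pc (.cls σ e) θ :=
  .of_pureRedex (.cls σ e) (.inr ⟨_, rfl, hpc⟩) fun _ hn => (h.mono hn.le (.refl _)).closed hpc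

theorem UExp.pair (h₁ : UExp lp m A₁ pc e₁ θ) (h₂ : UExp lp m A₂ pc e₂ θ) :
    UExp lp m (.prod A₁ p₁ A₂ p₂) pc (.pair e₁ e₂) θ := by
  refine h₁.bind (K := (.pair · e₂)) (.pairL e₂) fun n hn ϑ v hϑ hv => ?_
  refine (h₂.mono hn hϑ).bind (.pairR hv.isValue) fun k hk ϑ' w hϑ' hw => UVal.uExp ?_
  rw [UVal]
  exact ⟨v, w, rfl, hv.mono hk hϑ', hw⟩

theorem UExp.fst (h : UExp lp m (.prod A₁ p₁ A₂ p₂) pc e θ) : UExp lp m A₁ pc (.fst e) θ := by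
  refine h.bind .fst fun n _ ϑ v _ hv => ?_
  rw [UVal] at hv
  obtain ⟨w, w', rfl, hw, hw'⟩ := hv
  exact .of_pureRedex (.fst hw.isValue hw'.isValue) (.inl rfl)
    fun _ hk => (hw.mono hk.le (.refl _)).uExp

theorem UExp.snd (h : UExp lp m (.prod A₁ p₁ A₂ p₂) pc e θ) : UExp lp m A₂ pc (.snd e) θ := by
  refine h.bind .snd fun n _ ϑ v _ hv => ?_
  rw [UVal] at hv
  obtain ⟨w, w', rfl, hw, hw'⟩ := hv
  exact .of_pureRedex (.snd hw.isValue hw'.isValue) (.inl rfl)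
    fun _ hk => (hw'.mono hk.le (.refl _)).uExp

theorem UExp.inl (h : UExp lp m A₁ pc e θ) : UExp lp m (.sum A₁ p₁ A₂ p₂) pc (.inl e) θ := by
  refine h.bind .inl fun n _ ϑ v _ hv => UVal.uExp ?_
  rw [UVal]
  exact .inl ⟨v, rfl, hv⟩

theorem UExp.inr (h : UExp lp m A₂ pc e θ) : UExp lp m (.sum A₁ p₁ A₂ p₂) pc (.inr e) θ := by
  refine h.bind .inr fun n _ ϑ v _ hv => UVal.uExp ?_
  rw [UVal]
  exact .inr ⟨v, rfl, hv⟩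

theorem UExp.caseOf (h : UExp lp m (.sum A₁ p₁ A₂ p₂) pc e θ)
    (h₁ : ∀ n ≤ m, ∀ ϑ v, StateEnv.Le θ ϑ → UVal lp n A₁ v ϑ → UExp lp n B pc (e₁.inst v) ϑ)
    (h₂ : ∀ n ≤ m, ∀ ϑ v, StateEnv.Le θ ϑ → UVal lp n A₂ v ϑ → UExp lp n B pc (e₂.inst v) ϑ) :
    UExp lp m B pc (.caseOf e e₁ e₂) θ := by
  refine h.bind (K := (.caseOf · e₁ e₂)) (.caseOf e₁ e₂) fun n hn ϑ v hϑ hv => ?_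
  rw [UVal] at hv
  obtain ⟨w, rfl, hw⟩ | ⟨w, rfl, hw⟩ := hv
  · exact .of_pureRedex (.caseL hw.isValue e₁ e₂) (.inl rfl) fun k hk =>
      h₁ k (hk.le.trans hn) ϑ w hϑ (hw.mono hk.le (.refl _))
  · exact .of_pureRedex (.caseR hw.isValue e₁ e₂) (.inl rfl) fun k hk =>
      h₂ k (hk.le.trans hn) ϑ w hϑ (hw.mono hk.le (.refl _))

theorem UExp.app {L : Set Lock} (h₁ : UExp lp m (.arrow L pc' A₁ p₁ A₂ p₂) pc e₁ θ)
    (h₂ : UExp lp m A₁ pc e₂ θ) (hpc : pc.le pc') : UExp lp m A₂ pc (.app e₁ e₂) θ := by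
  refine h₁.bind (K := (.app · e₂)) (.appL e₂) fun n hn ϑ v hϑ hv => ?_
  rw [UVal] at hv
  obtain ⟨b, rfl, hb⟩ := hv
  refine (h₂.mono hn hϑ).bind (.appR b) fun k hk ϑ' w hϑ' hw => ?_
  exact .of_pureRedex (.app b hw.isValue) (.inl rfl) fun j hj =>
    (hb j (hj.trans_le hk) ϑ' w hϑ' (hw.mono hj.le (.refl _))).le_pc hpc

theorem UExp.deref (h : UExp lp m (.ref A q) pc e θ) : UExp lp m A pc (.deref e) θ := by
  refine h.bind .deref fun n _ ϑ v _ hv => ?_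
  rw [UVal] at hv
  obtain ⟨l, rfl, hl⟩ := hv
  refine UExp_iff.2 (.inr ⟨nofun, fun k hk ϑ' S hϑ' hS L r S' ω L' hr => ?_⟩)
  cases hr with
  | deref h => cases h
  | derefBeta hw =>
    obtain ⟨rfl, hu⟩ := hS.eq_of_lookup (hϑ' _ _ hl) hw
    exact ⟨.inl rfl, ϑ', .refl _, hS, hu.uExp⟩

theorem UExp.new (h : UExp lp m τ.ty pc e θ) (hpc : pc.le τ.pol) :
    UExp lp m (.ref τ.ty τ.pol) pc (.new e τ) θ := by
  refine h.bind (.new τ) fun n _ ϑ v _ hv => ?_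
  refine UExp_iff.2 (.inr ⟨nofun, fun k hk ϑ' S hϑ' hS L r S' ω L' hr => ?_⟩)
  cases hr with
  | new h => exact absurd h hv.isValue.not_step
  | @newBeta _ _ _ _ l hvv hl =>
    have hle := StateEnv.Le.update (hS.env_eq_none hl) τ
    refine ⟨.inr ⟨_, rfl, hpc⟩, _, hle, ?_, UVal.uExp ?_⟩
    · exact hS.set hle (fun j hj => Function.update_of_ne hj ..) (Function.update_self ..) hvv
        (hv.mono hk.le (hϑ'.trans hle))
    · rw [UVal]
      exact ⟨l, rfl, Function.update_self ..⟩

theorem UExp.assign (h₁ : UExp lp m (.ref A q) pc e₁ θ) (h₂ : UExp lp m A pc e₂ θ)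
    (hpc : pc.le q) : UExp lp m .unit pc (.assign e₁ e₂) θ := by
  refine h₁.bind (K := (.assign · e₂)) (.assignL e₂) fun n hn ϑ v hϑ hv => ?_
  rw [UVal] at hv
  obtain ⟨l, rfl, hl⟩ := hv
  refine (h₂.mono hn hϑ).bind (.assignR l) fun k hk ϑ' w hϑ' hw => ?_
  refine UExp_iff.2 (.inr ⟨nofun, fun j hj ϑ'' S hϑ'' hS L r S' ω L' hr => ?_⟩)
  cases hr with
  | assignL h => cases h
  | assignR h => exact absurd h hw.isValue.not_step
  | assignBeta hvv hlk =>
    have hl' := (hϑ'.trans hϑ'') _ _ hl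
    obtain ⟨rfl, -⟩ := hS.eq_of_lookup hl' hlk
    refine ⟨.inr ⟨_, rfl, hpc⟩, _, .refl _, ?_, UVal.uExp (by rw [UVal])⟩
    exact hS.set (.refl _) (fun _ _ => rfl) hl' hvv (hw.mono hj.le hϑ'')

/-- The lock `σ` may be opened and closed between two steps, so both branches can run in turn. -/
theorem UExp.whenOpen {σ : Lock} (h₁ : UExp lp m A pc e₁ θ) (h₂ : UExp lp m A pc e₂ θ) :
    UExp lp m A pc (.whenOpen σ e₁ e₂) θ := by
  induction m using Nat.strong_induction_on generalizing e₁ e₂ θ with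
  | _ m ih =>
    refine UExp_iff.2 (.inr ⟨nofun, fun n hn ϑ S hϑ hS L r S' ω L' hr => ?_⟩)
    cases hr with
    | whenOpen hσ hr =>
      obtain h | ⟨-, h⟩ := UExp_iff.1 h₁
      · exact absurd hr h.isValue.not_step
      · obtain ⟨hω, θ'', hθ'', hS', he'⟩ := h n hn ϑ S hϑ hS _ _ _ _ _ hr
        exact ⟨hω, θ'', hθ'', hS', ih n hn he' (h₂.mono hn.le (hϑ.trans hθ''))⟩
    | whenClosed hσ hr =>
      obtain h | ⟨-, h⟩ := UExp_iff.1 h₂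
      · exact absurd hr h.isValue.not_step
      · obtain ⟨hω, θ'', hθ'', hS', he'⟩ := h n hn ϑ S hϑ hS _ _ _ _ _ hr
        exact ⟨hω, θ'', hθ'', hS', ih n hn (h₁.mono hn.le (hϑ.trans hθ'')) he'⟩
    | whenOpenBeta => exact ⟨.inl rfl, ϑ, .refl ϑ, hS, h₁.mono hn.le hϑ⟩
    | whenClosedBeta => exact ⟨.inl rfl, ϑ, .refl ϑ, hS, h₂.mono hn.le hϑ⟩

/-- `(γ, θ, m) ∈ ⌊Γ⌋_V`: the substitution `γ` maps the variables of `Γ` to related values. -/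
def USubst (lp : Lock → Policy Actor Lock) (m : ℕ) (Γ : List (ATy Actor Lock))
    (γ : ℕ → Expr Actor Lock) (θ : StateEnv Actor Lock) : Prop :=
  ∀ i τ, Γ[i]? = some τ → UVal lp m τ.ty (γ i) θ

theorem USubst.cons {Γ : List (ATy Actor Lock)} {γ : ℕ → Expr Actor Lock}
    (h : USubst lp m Γ γ θ) (hm : m' ≤ m) (hθ : StateEnv.Le θ θ') (hv : UVal lp m' A v θ') :
    USubst lp m' (⟨A, p⟩ :: Γ) (consSubst v γ) θ' := by
  rintro (_ | i) τ hi
  · obtain rfl : _ = τ := Option.some.inj hi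
    exact hv
  · exact (h i τ hi).mono hm hθ

/-- The fundamental theorem for the unary relation. -/
theorem HasType.uExp {Γ : List (ATy Actor Lock)} {L : Set Lock} (h : HasType lp θ Γ L pc e τ)
    {γ : ℕ → Expr Actor Lock} (hγ : USubst lp m Γ γ θ') (hθ : StateEnv.Le θ θ') :
    UExp lp m τ.ty pc (e.subst γ) θ' := by
  induction h generalizing m γ θ' with
  | var hi => exact (hγ _ _ hi).uExp
  | unit => exact UVal.uExp (by rw [UVal, Expr.subst])
  | nat n => exact UVal.uExp (by rw [UVal]; exact ⟨n, rfl⟩)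
  | lam _ ih =>
    refine UVal.uExp ?_
    rw [UVal]
    refine ⟨_, rfl, fun n hn ϑ w hϑ hw => ?_⟩
    rw [Expr.inst_subst]
    exact ih (hγ.cons hn.le hϑ hw) (hθ.trans hϑ)
  | opn _ hpc ih => exact (ih hγ hθ).opn hpc
  | opened _ hpc ih => exact (ih hγ hθ).opened hpc
  | cls _ hpc ih => exact (ih hγ hθ).cls hpc
  | closed _ hpc ih => exact (ih hγ hθ).closed hpc
  | prod _ _ ih₁ ih₂ => exact (ih₁ hγ hθ).pair (ih₂ hγ hθ)
  | fst _ _ ih => exact (ih hγ hθ).fst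
  | snd _ _ ih => exact (ih hγ hθ).snd
  | inl _ ih => exact (ih hγ hθ).inl
  | inr _ ih => exact (ih hγ hθ).inr
  | caseOf _ _ _ _ ih ih₁ ih₂ =>
    refine (ih hγ hθ).caseOf ?_ ?_
    · intro n hn ϑ v hϑ hv
      rw [Expr.inst_subst]
      exact (ih₁ (hγ.cons hn hϑ hv) (hθ.trans hϑ)).le_pc (Policy.le_join_left _ _)
    · intro n hn ϑ v hϑ hv
      rw [Expr.inst_subst]
      exact (ih₂ (hγ.cons hn hϑ hv) (hθ.trans hϑ)).le_pc (Policy.le_join_left _ _)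
  | sub _ hpc hsub ih => exact (ih hγ hθ).sub hsub.2 hpc
  | app _ _ _ hpc hsub _ ih₁ ih₂ =>
    exact (ih₁ hγ hθ).app ((ih₂ hγ hθ).sub hsub.2 (Policy.le_refl _))
      (Policy.le_trans (Policy.le_join_left _ _) hpc)
  | deref _ _ hsub ih => exact (ih hγ hθ).deref.sub hsub.2 (Policy.le_refl _)
  | new _ hpc hsub ih => exact ((ih hγ hθ).sub hsub.2 (Policy.le_refl _)).new hpc
  | loc hl => exact UVal.uExp (by rw [UVal]; exact ⟨_, rfl, hθ _ _ hl⟩)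
  | assign _ hsub _ hpc ih₁ ih₂ =>
    exact (ih₁ hγ hθ).assign ((ih₂ hγ hθ).sub hsub.2 (Policy.le_refl _))
      (Policy.le_trans (Policy.le_join_left _ _) hpc)
  | whenOpen _ _ _ ih₁ ih₂ =>
    exact ((ih₁ hγ hθ).whenOpen (ih₂ hγ hθ)).le_pc (Policy.le_join_left _ _)

end

section

variable {Actor : Type u} {Lock : Type v}
variable {lp : Lock → Policy Actor Lock} {𝒜 : Attacker Actor Lock} {m m' : ℕ}
variable {A B A₁ A₂ : Ty Actor Lock} {p p₁ p₂ q pc pc' : Policy Actor Lock} {τ τ' : ATy Actor Lock}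
variable {e e' e₁ e₂ e₁' e₂' v v' : Expr Actor Lock} {θ : StateEnv Actor Lock}
variable {W W' : World Actor Lock} {L L' L₁ L₂ : Set Lock} {S₁ S₂ : State Actor Lock}

/-! ### Visibility and worlds -/

theorem Attacker.Sees.mono (h : 𝒜.Sees q) (hpq : p.le q) : 𝒜.Sees p := Policy.le_trans hpq h

theorem Attacker.sees_bot (𝒜 : Attacker Actor Lock) : 𝒜.Sees .bot :=
  fun _ _ _ => ⟨∅, rfl, Set.empty_subset _⟩

/-- If the open locks are within the capability of the attacker, a policy is visible as soon as its
specialization is. -/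
theorem Attacker.Sees.of_specialize (h : 𝒜.Sees (p.specialize L)) (hL : L ⊆ 𝒜.cap) :
    𝒜.Sees p := by
  intro M a hM
  obtain ⟨M', ⟨M₁, hM₁, rfl : M' = _⟩, hsub⟩ := h M a hM
  obtain ⟨rfl, -⟩ := Prod.mk.inj (Set.mem_singleton_iff.1 hM)
  exact ⟨M₁, hM₁, (Set.sdiff_subset_iff.1 hsub).trans (Set.union_subset hL subset_rfl)⟩

theorem LowEq.refl (L : Set Lock) : LowEq lp 𝒜 L L := Eq.refl _

theorem LowEq.mem_iff (h : LowEq lp 𝒜 L₁ L₂) {σ : Lock} (hσ : 𝒜.Sees (lp σ)) :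
    σ ∈ L₁ ↔ σ ∈ L₂ := by
  have := Set.ext_iff.1 h σ
  simpa [hσ] using this

theorem LowEq.of_mem_iff (h : ∀ σ, 𝒜.Sees (lp σ) → (σ ∈ L₁ ↔ σ ∈ L₂)) : LowEq lp 𝒜 L₁ L₂ :=
  Set.ext fun σ => and_congr_left (h σ)

theorem IsFrame.lowEq {f : Set Lock → Set Lock} {K : Expr Actor Lock → Expr Actor Lock}
    (hK : IsFrame f K) (h : LowEq lp 𝒜 L₁ L₂) : LowEq lp 𝒜 (f L₁) (f L₂) :=
  .of_mem_iff fun _ hσ => hK.mem_congr (h.mem_iff hσ)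

theorem World.Le.refl (W : World Actor Lock) : W.Le W := ⟨.refl _, .refl _, fun _ _ => id⟩

theorem World.Le.trans {W'' : World Actor Lock} (h : W.Le W') (h' : W'.Le W'') : W.Le W'' :=
  ⟨h.1.trans h'.1, h.2.1.trans h'.2.1, fun _ _ hl => h'.2.2 _ _ (h.2.2 _ _ hl)⟩

/-! ### The binary value relation -/

theorem Annot.imp {R U₁ U₂ R' U₁' U₂' : Prop} (h : Annot 𝒜 p R U₁ U₂) (hR : R → R')
    (h₁ : U₁ → U₁') (h₂ : U₂ → U₂') : Annot 𝒜 p R' U₁' U₂' :=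
  Or.imp (And.imp_right hR) (And.imp_right (And.imp h₁ h₂)) h

theorem Annot.unary {R U₁ U₂ : Prop} (h : Annot 𝒜 p R U₁ U₂) (hR : R → U₁ ∧ U₂) : U₁ ∧ U₂ :=
  h.elim (fun h => hR h.2) (fun h => h.2)

/-- Raising the policy may make the value invisible, which is sound because the binary relation is
contained in the unary one. -/
theorem Annot.raise {R U₁ U₂ : Prop} (h : Annot 𝒜 p R U₁ U₂) (hR : R → U₁ ∧ U₂) (hpq : p.le q) :
    Annot 𝒜 q R U₁ U₂ := by
  by_cases hq : 𝒜.Sees q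
  · exact .inl ⟨hq, h.elim (·.2) fun h => absurd (hq.mono hpq) h.1⟩
  · exact .inr ⟨hq, h.unary hR⟩

theorem BVal.unary (h : BVal lp 𝒜 m A v v' W) : UVal lp m A v W.θ₁ ∧ UVal lp m A v' W.θ₂ := by
  induction A generalizing v v' with
  | unit => simpa only [BVal, UVal] using h
  | nat =>
    simp only [BVal] at h
    obtain ⟨n, rfl, rfl⟩ := h
    simp only [UVal]
    exact ⟨⟨n, rfl⟩, n, rfl⟩
  | prod A₁ p₁ A₂ p₂ ih₁ ih₂ =>
    simp only [BVal] at h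
    obtain ⟨v₁, v₂, v₁', v₂', rfl, rfl, h₁, h₂⟩ := h
    simp only [UVal]
    have h₁ := h₁.unary ih₁
    have h₂ := h₂.unary ih₂
    exact ⟨⟨_, _, rfl, h₁.1, h₂.1⟩, _, _, rfl, h₁.2, h₂.2⟩
  | sum A₁ p₁ A₂ p₂ ih₁ ih₂ =>
    simp only [BVal] at h
    simp only [UVal]
    obtain ⟨w, w', rfl, rfl, h⟩ | ⟨w, w', rfl, rfl, h⟩ := h
    · have h := h.unary ih₁
      exact ⟨.inl ⟨_, rfl, h.1⟩, .inl ⟨_, rfl, h.2⟩⟩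
    · have h := h.unary ih₂
      exact ⟨.inr ⟨_, rfl, h.1⟩, .inr ⟨_, rfl, h.2⟩⟩
  | ref A p =>
    simp only [BVal] at h
    obtain ⟨l, l', rfl, rfl, h, h', -⟩ := h
    simp only [UVal]
    exact ⟨⟨l, rfl, h⟩, l', rfl, h'⟩
  | arrow =>
    rw [BVal] at h
    exact h.2

theorem BVal.mono (h : BVal lp 𝒜 m A v v' W) (hm : m' ≤ m) (hW : W.Le W') :
    BVal lp 𝒜 m' A v v' W' := by
  induction A generalizing v v' with
  | unit | nat => simpa only [BVal] using h
  | prod A₁ p₁ A₂ p₂ ih₁ ih₂ =>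
    simp only [BVal] at h ⊢
    obtain ⟨v₁, v₂, v₁', v₂', hv, hv', h₁, h₂⟩ := h
    exact ⟨v₁, v₂, v₁', v₂', hv, hv', h₁.imp ih₁ (·.mono hm hW.1) (·.mono hm hW.2.1),
      h₂.imp ih₂ (·.mono hm hW.1) (·.mono hm hW.2.1)⟩
  | sum A₁ p₁ A₂ p₂ ih₁ ih₂ =>
    simp only [BVal] at h ⊢
    exact h.imp
      (fun ⟨w, w', hv, hv', h⟩ => ⟨w, w', hv, hv', h.imp ih₁ (·.mono hm hW.1) (·.mono hm hW.2.1)⟩)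
      (fun ⟨w, w', hv, hv', h⟩ => ⟨w, w', hv, hv', h.imp ih₂ (·.mono hm hW.1) (·.mono hm hW.2.1)⟩)
  | ref A p =>
    simp only [BVal] at h ⊢
    obtain ⟨l, l', hv, hv', h, h', hβ⟩ := h
    exact ⟨l, l', hv, hv', hW.1 _ _ h, hW.2.1 _ _ h', hW.2.2 _ _ hβ⟩
  | arrow =>
    rw [BVal] at h ⊢
    obtain ⟨⟨e, e', hv, hv', h⟩, hu, hu'⟩ := h
    exact ⟨⟨e, e', hv, hv', fun n hn W'' hW'' => h n (hn.trans_le hm) W'' (hW.trans hW'')⟩,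
      hu.mono hm hW.1, hu'.mono hm hW.2.1⟩

theorem BValA.unary (h : BValA lp 𝒜 m τ v v' W) :
    UVal lp m τ.ty v W.θ₁ ∧ UVal lp m τ.ty v' W.θ₂ := Annot.unary h BVal.unary

theorem BValA.mono (h : BValA lp 𝒜 m τ v v' W) (hm : m' ≤ m) (hW : W.Le W') :
    BValA lp 𝒜 m' τ v v' W' := Annot.imp h (·.mono hm hW) (·.mono hm hW.1) (·.mono hm hW.2.1)

theorem BValA.bVal (h : BValA lp 𝒜 m τ v v' W) (hτ : 𝒜.Sees τ.pol) :
    BVal lp 𝒜 m τ.ty v v' W := h.elim (·.2) fun h => absurd hτ h.1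

theorem BVal.bValA_bot (h : BVal lp 𝒜 m A v v' W) : BValA lp 𝒜 m ⟨A, .bot⟩ v v' W :=
  .inl ⟨𝒜.sees_bot, h⟩

theorem BValA.of_not_sees (hτ : ¬ 𝒜.Sees τ.pol) (h : UVal lp m τ.ty v W.θ₁)
    (h' : UVal lp m τ.ty v' W.θ₂) : BValA lp 𝒜 m τ v v' W := .inr ⟨hτ, h, h'⟩

/-! ### The binary expression relation -/

/-- The alternative (Par), (L) or (R) of the binary expression relation. -/
def BStep (lp : Lock → Policy Actor Lock) (𝒜 : Attacker Actor Lock) (m : ℕ)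
    (E : Expr Actor Lock → Expr Actor Lock → World Actor Lock → Prop)
    (L₁ L₂ : Set Lock) (W : World Actor Lock) (S₁ S₂ : State Actor Lock)
    (e₁ e₂ : Expr Actor Lock) : Prop :=
  CPar lp 𝒜 m (BValA lp 𝒜 m) E L₁ L₂ W S₁ S₂ e₁ e₂ ∨
  CLeft lp 𝒜 m (BValA lp 𝒜 m) E L₁ W S₁ S₂ e₁ e₂ ∨
  CRight lp 𝒜 m (BValA lp 𝒜 m) E L₂ W S₁ S₂ e₁ e₂

theorem BExp_iff : BExp lp 𝒜 m τ e₁ e₂ W L L' ↔ BValA lp 𝒜 m τ e₁ e₂ W ∨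
    (LowEq lp 𝒜 L L' ∧
      ∀ L₁ L₂, L ⊆ L₁ → L' ⊆ L₂ → LowEq lp 𝒜 L₁ L₂ →
      ∀ m' < m, ∀ (W' : World Actor Lock) (S₁ S₂ : State Actor Lock), W.Le W' →
        StateRel lp m' (BValA lp 𝒜 m') S₁ S₂ W' →
        BStep lp 𝒜 m' (fun e e' W₀ => BExp lp 𝒜 m' τ e e' W₀ L L') L₁ L₂ W' S₁ S₂ e₁ e₂) := by
  rw [BExp]
  rfl

/-- Transfer of the three alternatives from `e₁` and `e₂` to `K₁ e₁` and `K₂ e₂`, where each step of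
`Kᵢ eᵢ` is a step of `eᵢ` unless `eᵢ` is a value. -/
theorem BStep.frame {E E' : Expr Actor Lock → Expr Actor Lock → World Actor Lock → Prop}
    {K₁ K₂ : Expr Actor Lock → Expr Actor Lock} {M₁ M₂ : Set Lock}
    (h : BStep lp 𝒜 m E M₁ M₂ W S₁ S₂ e₁ e₂)
    (h₁ : ¬ IsValue e₁ → ¬ IsValue (K₁ e₁) ∧ ∀ {r S' ω L'}, Step (K₁ e₁) L₁ S₁ r S' ω L' →
      ∃ e', r = K₁ e' ∧ Step e₁ M₁ S₁ e' S' ω L')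
    (h₂ : ¬ IsValue e₂ → ¬ IsValue (K₂ e₂) ∧ ∀ {r S' ω L'}, Step (K₂ e₂) L₂ S₂ r S' ω L' →
      ∃ e', r = K₂ e' ∧ Step e₂ M₂ S₂ e' S' ω L')
    (hE : ∀ e e' W', W.Le W' → E e e' W' → E' (K₁ e) (K₂ e') W') :
    BStep lp 𝒜 m E' L₁ L₂ W S₁ S₂ (K₁ e₁) (K₂ e₂) := by
  obtain ⟨hv₁, hv₂, h⟩ | ⟨hv, h⟩ | ⟨hv, h⟩ := h
  · obtain ⟨hk₁, inv₁⟩ := h₁ hv₁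
    obtain ⟨hk₂, inv₂⟩ := h₂ hv₂
    refine .inl ⟨hk₁, hk₂, fun r₁ S₁' ω M₁' r₂ S₂' ω' M₂' hr₁ hr₂ hω => ?_⟩
    obtain ⟨f₁, rfl, hf₁⟩ := inv₁ hr₁
    obtain ⟨f₂, rfl, hf₂⟩ := inv₂ hr₂
    obtain ⟨W', hW, hS, hω', he⟩ := h _ _ _ _ _ _ _ _ hf₁ hf₂ hω
    exact ⟨W', hW, hS, hω', hE _ _ _ hW he⟩
  · obtain ⟨hk, inv⟩ := h₁ hv
    refine .inr (.inl ⟨hk, fun r S' ω M' hr => ?_⟩)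
    obtain ⟨f, rfl, hf⟩ := inv hr
    obtain ⟨hω, W', hW, hS, he⟩ := h _ _ _ _ hf
    exact ⟨hω, W', hW, hS, hE _ _ _ hW he⟩
  · obtain ⟨hk, inv⟩ := h₂ hv
    refine .inr (.inr ⟨hk, fun r S' ω M' hr => ?_⟩)
    obtain ⟨f, rfl, hf⟩ := inv hr
    obtain ⟨hω, W', hW, hS, he⟩ := h _ _ _ _ hf
    exact ⟨hω, W', hW, hS, hE _ _ _ hW he⟩

theorem BStep.imp {E E' : Expr Actor Lock → Expr Actor Lock → World Actor Lock → Prop}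
    (h : BStep lp 𝒜 m E L₁ L₂ W S₁ S₂ e₁ e₂) (hE : ∀ e e' W', E e e' W' → E' e e' W') :
    BStep lp 𝒜 m E' L₁ L₂ W S₁ S₂ e₁ e₂ :=
  h.frame (K₁ := id) (K₂ := id) (fun hv => ⟨hv, fun h => ⟨_, rfl, h⟩⟩)
    (fun hv => ⟨hv, fun h => ⟨_, rfl, h⟩⟩) fun e e' W' _ => hE e e' W'

theorem BExp.mono (h : BExp lp 𝒜 m τ e₁ e₂ W L L') (hm : m' ≤ m) (hW : W.Le W') :
    BExp lp 𝒜 m' τ e₁ e₂ W' L L' := by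
  rw [BExp_iff] at h ⊢
  exact h.imp (·.mono hm hW) fun ⟨hL, h⟩ => ⟨hL, fun L₁ L₂ h₁ h₂ hLe n hn W'' S₁ S₂ hW'' =>
    h L₁ L₂ h₁ h₂ hLe n (hn.trans_le hm) W'' S₁ S₂ (hW.trans hW'')⟩

theorem BValA.bExp (h : BValA lp 𝒜 m τ v v' W) : BExp lp 𝒜 m τ v v' W L L' := BExp_iff.2 (.inl h)

/-- Subtyping for values, and subtyping together with enlargement of the lock sets for expressions, by
simultaneous induction on the step index. -/
theorem binary_sub (m : ℕ) :
    (∀ {A B : Ty Actor Lock} {v v' W}, Sub A B → BVal lp 𝒜 m A v v' W → BVal lp 𝒜 m B v v' W) ∧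
    (∀ {τ τ' : ATy Actor Lock} {e e' W L L' L₁ L₂}, SubA τ τ' → L ⊆ L₁ → L' ⊆ L₂ →
      LowEq lp 𝒜 L₁ L₂ → BExp lp 𝒜 m τ e e' W L L' → BExp lp 𝒜 m τ' e e' W L₁ L₂) := by
  induction m using Nat.strong_induction_on with
  | _ m ih =>
    have hV : ∀ {A B : Ty Actor Lock} {v v' W}, Sub A B →
        BVal lp 𝒜 m A v v' W → BVal lp 𝒜 m B v v' W := by
      intro A B v v' W hAB
      induction hAB generalizing v v' with
      | unit | nat | ref => exact id
      | prod hp₁ h₁ hp₂ h₂ ih₁ ih₂ =>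
        simp only [BVal]
        rintro ⟨v₁, v₂, v₁', v₂', hv, hv', hb₁, hb₂⟩
        exact ⟨v₁, v₂, v₁', v₂', hv, hv', (hb₁.raise BVal.unary hp₁).imp ih₁ (·.sub h₁) (·.sub h₁),
          (hb₂.raise BVal.unary hp₂).imp ih₂ (·.sub h₂) (·.sub h₂)⟩
      | sum hp₁ h₁ hp₂ h₂ ih₁ ih₂ =>
        simp only [BVal]
        exact Or.imp
          (fun ⟨w, w', hv, hv', h⟩ =>
            ⟨w, w', hv, hv', (h.raise BVal.unary hp₁).imp ih₁ (·.sub h₁) (·.sub h₁)⟩)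
          (fun ⟨w, w', hv, hv', h⟩ =>
            ⟨w, w', hv, hv', (h.raise BVal.unary hp₂).imp ih₂ (·.sub h₂) (·.sub h₂)⟩)
      | arrow hp₁ h₁ hp₂ h₂ hpc hL =>
        rw [BVal, BVal]
        rintro ⟨⟨e, e', hv, hv', h⟩, hu, hu'⟩
        refine ⟨⟨e, e', hv, hv', fun n hn W' hW' w w' hw L₁ L₂ hL₁ hL₂ hLe => ?_⟩,
          hu.sub (.arrow hp₁ h₁ hp₂ h₂ hpc hL), hu'.sub (.arrow hp₁ h₁ hp₂ h₂ hpc hL)⟩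
        refine (ih n hn).2 ⟨hp₂, h₂⟩ subset_rfl subset_rfl hLe
          (h n hn W' hW' w w' ?_ L₁ L₂ (hL.trans hL₁) (hL.trans hL₂) hLe)
        exact (hw.raise BVal.unary hp₁).imp ((ih n hn).1 h₁) (·.sub h₁) (·.sub h₁)
    refine ⟨hV, fun hτ hL hL' hLe h => ?_⟩
    rw [BExp_iff] at h ⊢
    refine h.imp (fun h => ?_) fun ⟨_, h⟩ => ⟨hLe, ?_⟩
    · exact (Annot.raise h BVal.unary hτ.1).imp (hV hτ.2) (·.sub hτ.2) (·.sub hτ.2)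
    · intro M₁ M₂ hM₁ hM₂ hM n hn W' S₁ S₂ hW' hS
      exact (h M₁ M₂ (hL.trans hM₁) (hL'.trans hM₂) hM n hn W' S₁ S₂ hW' hS).imp
        fun _ _ _ he => (ih n hn).2 hτ hL hL' hLe he

theorem BValA.sub (h : BValA lp 𝒜 m τ v v' W) (hτ : SubA τ τ') : BValA lp 𝒜 m τ' v v' W :=
  (Annot.raise h BVal.unary hτ.1).imp ((binary_sub m).1 hτ.2) (·.sub hτ.2) (·.sub hτ.2)

theorem BExp.sub (h : BExp lp 𝒜 m τ e₁ e₂ W L L') (hτ : SubA τ τ') (hL : LowEq lp 𝒜 L L') :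
    BExp lp 𝒜 m τ' e₁ e₂ W L L' := (binary_sub m).2 hτ subset_rfl subset_rfl hL h

theorem BExp.mono_locks (h : BExp lp 𝒜 m τ e₁ e₂ W L L') (h₁ : L ⊆ L₁) (h₂ : L' ⊆ L₂)
    (hL : LowEq lp 𝒜 L₁ L₂) : BExp lp 𝒜 m τ e₁ e₂ W L₁ L₂ :=
  (binary_sub m).2 (.refl τ) h₁ h₂ hL h

/-- To relate `K₁ e₁` and `K₂ e₂`, it is enough to relate `K₁ v₁` and `K₂ v₂` for the related values that
`e₁` and `e₂` may reduce to. -/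
theorem BExp.bind {f : Set Lock → Set Lock} {K₁ K₂ : Expr Actor Lock → Expr Actor Lock}
    (hK₁ : IsFrame f K₁) (hK₂ : IsFrame f K₂) (h : BExp lp 𝒜 m τ e₁ e₂ W (f L) (f L))
    (hv : ∀ n ≤ m, ∀ W' v v', W.Le W' → BValA lp 𝒜 n τ v v' W' →
      BExp lp 𝒜 n τ' (K₁ v) (K₂ v') W' L L) :
    BExp lp 𝒜 m τ' (K₁ e₁) (K₂ e₂) W L L := by
  induction m using Nat.strong_induction_on generalizing e₁ e₂ W with
  | _ m ih =>
    obtain h | ⟨-, h⟩ := BExp_iff.1 h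
    · exact hv m le_rfl W e₁ e₂ (.refl W) h
    · refine BExp_iff.2 (.inr ⟨.refl L, fun L₁ L₂ hL₁ hL₂ hL n hn W' S₁ S₂ hW' hS => ?_⟩)
      refine (h (f L₁) (f L₂) (hK₁.mono hL₁) (hK₁.mono hL₂) (hK₁.lowEq hL) n hn W' S₁ S₂ hW'
        hS).frame (fun he => ⟨hK₁.not_value _ he, hK₁.step_inv he⟩)
        (fun he => ⟨hK₂.not_value _ he, hK₂.step_inv he⟩) fun e e' W'' hW'' he => ?_
      exact ih n hn he fun k hk W₀ v v' hW₀ =>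
        hv k (hk.trans hn.le) W₀ v v' ((hW'.trans hW'').trans hW₀)

/-- Two expressions without visible effects and with a type that is invisible to the attacker are
related: each of them can be reduced on its own, using (L) and (R). -/
theorem BExp.of_not_sees (hpc : ¬ 𝒜.Sees pc) (hτ : ¬ 𝒜.Sees τ.pol)
    (h₁ : UExp lp m τ.ty pc e₁ W.θ₁) (h₂ : UExp lp m τ.ty pc e₂ W.θ₂) (hL : LowEq lp 𝒜 L L') :
    BExp lp 𝒜 m τ e₁ e₂ W L L' := by
  induction m using Nat.strong_induction_on generalizing e₁ e₂ W with
  | _ m ih =>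
    have hvis : ∀ {ω : Obs Actor Lock}, (ω = .eps ∨ ∃ p, ω.pol lp = some p ∧ pc.le p) →
        ¬ ω.Visible lp 𝒜 := by
      rintro ω hω ⟨p, hp, hs⟩
      obtain rfl | ⟨p', hp', hle⟩ := hω
      · simp [Obs.pol] at hp
      · obtain rfl : p' = p := Option.some.inj (hp'.symm.trans hp)
        exact hpc (hs.mono hle)
    -- the contents of a location with a visible type are not changed by an invisible step
    have hkeep : ∀ {e L S e' S' ω L'}, Step (Actor := Actor) (Lock := Lock) e L S e' S' ω L' →
        ¬ ω.Visible lp 𝒜 → ∀ {l v τ}, 𝒜.Sees τ.pol → S.lookup l = some (v, τ) →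
        S'.lookup l = some (v, τ) := by
      intro e L S e' S' ω L' hs hω l v τ hτ hl
      refine (hs.lookup hl).resolve_right ?_
      rintro ⟨w, rfl⟩
      exact hω ⟨_, rfl, hτ⟩
    by_cases hv₁ : UVal lp m τ.ty e₁ W.θ₁
    · by_cases hv₂ : UVal lp m τ.ty e₂ W.θ₂
      · exact (BValA.of_not_sees hτ hv₁ hv₂).bExp
      · obtain ⟨he, h⟩ := (UExp_iff.1 h₂).resolve_left hv₂
        refine BExp_iff.2 (.inr ⟨hL, fun L₁ L₂ _ _ _ n hn W' S₁ S₂ hW' hS => ?_⟩)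
        refine .inr (.inr ⟨he, fun e' S' ω M hs => ?_⟩)
        obtain ⟨hω, θ', hθ', hS', he'⟩ := h n hn _ _ hW'.2.1 hS.2.1 _ _ _ _ _ hs
        have hle : W'.Le { W' with θ₂ := θ' } := ⟨.refl _, hθ', fun _ _ => id⟩
        refine ⟨hvis hω, { W' with θ₂ := θ' }, hle, ⟨hS.1, hS', fun l₁ l₂ hl => ?_⟩,
          ih n hn (h₁.mono hn.le hW'.1) he'⟩
        obtain ⟨ρ, w₁, w₂, hρ₁, hρ₂, hw₁, hw₂, hw⟩ := hS.2.2 l₁ l₂ hl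
        by_cases hρ : 𝒜.Sees ρ.pol
        · exact ⟨ρ, w₁, w₂, hρ₁, hθ' _ _ hρ₂, hw₁, hkeep hs (hvis hω) hρ hw₂, hw.mono le_rfl hle⟩
        · obtain ⟨w, hw', hu⟩ := hS' l₂ ρ (hθ' _ _ hρ₂)
          exact ⟨ρ, w₁, w, hρ₁, hθ' _ _ hρ₂, hw₁, hw', .of_not_sees hρ hw.unary.1 hu⟩
    · obtain ⟨he, h⟩ := (UExp_iff.1 h₁).resolve_left hv₁
      refine BExp_iff.2 (.inr ⟨hL, fun L₁ L₂ _ _ _ n hn W' S₁ S₂ hW' hS => ?_⟩)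
      refine .inr (.inl ⟨he, fun e' S' ω M hs => ?_⟩)
      obtain ⟨hω, θ', hθ', hS', he'⟩ := h n hn _ _ hW'.1 hS.1 _ _ _ _ _ hs
      have hle : W'.Le { W' with θ₁ := θ' } := ⟨hθ', .refl _, fun _ _ => id⟩
      refine ⟨hvis hω, { W' with θ₁ := θ' }, hle, ⟨hS', hS.2.1, fun l₁ l₂ hl => ?_⟩,
        ih n hn he' (h₂.mono hn.le hW'.2.1)⟩
      obtain ⟨ρ, w₁, w₂, hρ₁, hρ₂, hw₁, hw₂, hw⟩ := hS.2.2 l₁ l₂ hl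
      by_cases hρ : 𝒜.Sees ρ.pol
      · exact ⟨ρ, w₁, w₂, hθ' _ _ hρ₁, hρ₂, hkeep hs (hvis hω) hρ hw₁, hw₂, hw.mono le_rfl hle⟩
      · obtain ⟨w, hw', hu⟩ := hS' l₁ ρ (hθ' _ _ hρ₁)
        exact ⟨ρ, w, w₂, hθ' _ _ hρ₁, hρ₂, hw', hw₂, .of_not_sees hρ hu hw.unary.2⟩

/-- Two non-values are related if all their steps can be matched. -/
theorem BExp.of_cPar (hv₁ : ¬ IsValue e₁) (hv₂ : ¬ IsValue e₂)
    (h : ∀ L₁ L₂, L ⊆ L₁ → L ⊆ L₂ → ∀ n < m, ∀ (W' : World Actor Lock) S₁ S₂, W.Le W' →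
      StateRel lp n (BValA lp 𝒜 n) S₁ S₂ W' → ∀ e₁' S₁' ω L₁' e₂' S₂' ω' L₂',
      Step e₁ L₁ S₁ e₁' S₁' ω L₁' → Step e₂ L₂ S₂ e₂' S₂' ω' L₂' →
      (ObsIrrel lp 𝒜 (BValA lp 𝒜 n) W' ω ω' ∨ L₁' ⊆ 𝒜.cap ∨ L₂' ⊆ 𝒜.cap) →
      ∃ W'' : World Actor Lock, W'.Le W'' ∧ StateRel lp n (BValA lp 𝒜 n) S₁' S₂' W'' ∧
        ObsIndist lp 𝒜 (BValA lp 𝒜 n) W'' ω ω' ∧ BExp lp 𝒜 n τ e₁' e₂' W'' L L) :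
    BExp lp 𝒜 m τ e₁ e₂ W L L :=
  BExp_iff.2 <| .inr ⟨.refl L, fun L₁ L₂ hL₁ hL₂ _ n hn W' S₁ S₂ hW' hS =>
    .inl ⟨hv₁, hv₂, fun _ _ _ _ _ _ _ _ hs₁ hs₂ hω =>
      h L₁ L₂ hL₁ hL₂ n hn W' S₁ S₂ hW' hS _ _ _ _ _ _ _ _ hs₁ hs₂ hω⟩⟩

theorem BExp.of_pureRedex {ω : Obs Actor Lock} (h₁ : PureRedex e₁ ω e₁') (h₂ : PureRedex e₂ ω e₂')
    (h : ∀ n < m, BExp lp 𝒜 n τ e₁' e₂' W L L) : BExp lp 𝒜 m τ e₁ e₂ W L L := by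
  refine .of_cPar h₁.not_value h₂.not_value ?_
  intro L₁ L₂ _ _ n hn W' S₁ S₂ hW' hS _ _ _ _ _ _ _ _ hs₁ hs₂ _
  obtain ⟨rfl, rfl, rfl⟩ := h₁.step_inv hs₁
  obtain ⟨rfl, rfl, rfl⟩ := h₂.step_inv hs₂
  exact ⟨W', .refl W', hS, .refl h₁.not_write, (h n hn).mono le_rfl hW'⟩

/-! ### Compatibility of the binary relation with the typing rules -/

theorem BExp.opened {σ : Lock} (h : BExp lp 𝒜 m τ e₁ e₂ W (L ∪ {σ}) (L ∪ {σ})) :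
    BExp lp 𝒜 m τ (.opened σ e₁) (.opened σ e₂) W L L :=
  h.bind (f := (· ∪ {σ})) (.opened σ) (.opened σ) fun _ _ _ _ _ _ hv =>
    .of_pureRedex (.opened σ hv.unary.1.isValue) (.opened σ hv.unary.2.isValue)
      fun _ hn => (hv.mono hn.le (.refl _)).bExp

theorem BExp.opn {σ : Lock} (h : BExp lp 𝒜 m τ e₁ e₂ W (L ∪ {σ}) (L ∪ {σ})) :
    BExp lp 𝒜 m τ (.opn σ e₁) (.opn σ e₂) W L L :=
  .of_pureRedex (.opn σ e₁) (.opn σ e₂) fun _ hn => (h.mono hn.le (.refl _)).opened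

theorem BExp.closed {σ : Lock} (h : BExp lp 𝒜 m τ e₁ e₂ W (L \ {σ}) (L \ {σ})) :
    BExp lp 𝒜 m τ (.closed σ e₁) (.closed σ e₂) W L L :=
  h.bind (f := (· \ {σ})) (.closed σ) (.closed σ) fun _ _ _ _ _ _ hv =>
    .of_pureRedex (.closed σ hv.unary.1.isValue) (.closed σ hv.unary.2.isValue)
      fun _ hn => (hv.mono hn.le (.refl _)).bExp

theorem BExp.cls {σ : Lock} (h : BExp lp 𝒜 m τ e₁ e₂ W (L \ {σ}) (L \ {σ})) :
    BExp lp 𝒜 m τ (.cls σ e₁) (.cls σ e₂) W L L :=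
  .of_pureRedex (.cls σ e₁) (.cls σ e₂) fun _ hn => (h.mono hn.le (.refl _)).closed

theorem BExp.pair (h₁ : BExp lp 𝒜 m ⟨A₁, p₁⟩ e₁ e₂ W L L)
    (h₂ : BExp lp 𝒜 m ⟨A₂, p₂⟩ e₁' e₂' W L L) :
    BExp lp 𝒜 m ⟨.prod A₁ p₁ A₂ p₂, .bot⟩ (.pair e₁ e₁') (.pair e₂ e₂') W L L := by
  refine h₁.bind (K₁ := (.pair · e₁')) (K₂ := (.pair · e₂')) (.pairL _) (.pairL _)
    fun n hn W' v v' hW' hv => ?_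
  refine (h₂.mono hn hW').bind (.pairR hv.unary.1.isValue) (.pairR hv.unary.2.isValue)
    fun k hk W'' w w' hW'' hw => (BVal.bValA_bot ?_).bExp
  rw [BVal]
  exact ⟨v, w, v', w', rfl, rfl, hv.mono hk hW'', hw⟩

/-- A projection of an invisible pair has an invisible type, so that unary relatedness suffices. -/
theorem BExp.fst (h : BExp lp 𝒜 m ⟨.prod A₁ p₁ A₂ p₂, p⟩ e₁ e₂ W L L) (hp : p.le p₁) :
    BExp lp 𝒜 m ⟨A₁, p₁⟩ (.fst e₁) (.fst e₂) W L L := by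
  refine h.bind .fst .fst fun n _ W' v v' _ hv => ?_
  obtain ⟨hu, hu'⟩ := hv.unary
  simp only [UVal] at hu hu'
  obtain ⟨v₁, v₂, rfl, hv₁, hv₂⟩ := hu
  obtain ⟨v₁', v₂', rfl, hv₁', hv₂'⟩ := hu'
  have hb : BValA lp 𝒜 n ⟨A₁, p₁⟩ v₁ v₁' W' := by
    by_cases hs : 𝒜.Sees p
    · have hb := hv.bVal hs
      simp only [BVal] at hb
      obtain ⟨_, _, _, _, ⟨⟩, ⟨⟩, hb, -⟩ := hb
      exact hb
    · exact .of_not_sees (fun h => hs (h.mono hp)) hv₁ hv₁'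
  exact .of_pureRedex (.fst hv₁.isValue hv₂.isValue) (.fst hv₁'.isValue hv₂'.isValue)
    fun _ hk => (hb.mono hk.le (.refl _)).bExp

theorem BExp.snd (h : BExp lp 𝒜 m ⟨.prod A₁ p₁ A₂ p₂, p⟩ e₁ e₂ W L L) (hp : p.le p₂) :
    BExp lp 𝒜 m ⟨A₂, p₂⟩ (.snd e₁) (.snd e₂) W L L := by
  refine h.bind .snd .snd fun n _ W' v v' _ hv => ?_
  obtain ⟨hu, hu'⟩ := hv.unary
  simp only [UVal] at hu hu'
  obtain ⟨v₁, v₂, rfl, hv₁, hv₂⟩ := hu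
  obtain ⟨v₁', v₂', rfl, hv₁', hv₂'⟩ := hu'
  have hb : BValA lp 𝒜 n ⟨A₂, p₂⟩ v₂ v₂' W' := by
    by_cases hs : 𝒜.Sees p
    · have hb := hv.bVal hs
      simp only [BVal] at hb
      obtain ⟨_, _, _, _, ⟨⟩, ⟨⟩, -, hb⟩ := hb
      exact hb
    · exact .of_not_sees (fun h => hs (h.mono hp)) hv₂ hv₂'
  exact .of_pureRedex (.snd hv₁.isValue hv₂.isValue) (.snd hv₁'.isValue hv₂'.isValue)
    fun _ hk => (hb.mono hk.le (.refl _)).bExp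

theorem BExp.inl (h : BExp lp 𝒜 m ⟨A₁, p₁⟩ e₁ e₂ W L L) :
    BExp lp 𝒜 m ⟨.sum A₁ p₁ A₂ p₂, .bot⟩ (.inl e₁) (.inl e₂) W L L := by
  refine h.bind .inl .inl fun n _ W' v v' _ hv => (BVal.bValA_bot ?_).bExp
  rw [BVal]
  exact .inl ⟨v, v', rfl, rfl, hv⟩

theorem BExp.inr (h : BExp lp 𝒜 m ⟨A₂, p₂⟩ e₁ e₂ W L L) :
    BExp lp 𝒜 m ⟨.sum A₁ p₁ A₂ p₂, .bot⟩ (.inr e₁) (.inr e₂) W L L := by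
  refine h.bind .inr .inr fun n _ W' v v' _ hv => (BVal.bValA_bot ?_).bExp
  rw [BVal]
  exact .inr ⟨v, v', rfl, rfl, hv⟩

/-- If the scrutinee is invisible, the two runs may take different branches. Then the effects of the
branches and the type of the result are invisible as well, and unary relatedness suffices. -/
theorem BExp.caseOf {b₁ b₂ b₁' b₂' : Expr Actor Lock}
    (h : BExp lp 𝒜 m ⟨.sum A₁ p₁ A₂ p₂, p⟩ e₁ e₂ W L L) (hp : p.le τ.pol)
    (h₁ : ∀ n ≤ m, ∀ W' v v', W.Le W' → BValA lp 𝒜 n ⟨A₁, p₁⟩ v v' W' →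
      BExp lp 𝒜 n τ (b₁.inst v) (b₂.inst v') W' L L)
    (h₂ : ∀ n ≤ m, ∀ W' v v', W.Le W' → BValA lp 𝒜 n ⟨A₂, p₂⟩ v v' W' →
      BExp lp 𝒜 n τ (b₁'.inst v) (b₂'.inst v') W' L L)
    (u₁ : ∀ n ≤ m, ∀ ϑ v, StateEnv.Le W.θ₁ ϑ → UVal lp n A₁ v ϑ →
      UExp lp n τ.ty p (b₁.inst v) ϑ)
    (u₁' : ∀ n ≤ m, ∀ ϑ v, StateEnv.Le W.θ₁ ϑ → UVal lp n A₂ v ϑ →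
      UExp lp n τ.ty p (b₁'.inst v) ϑ)
    (u₂ : ∀ n ≤ m, ∀ ϑ v, StateEnv.Le W.θ₂ ϑ → UVal lp n A₁ v ϑ →
      UExp lp n τ.ty p (b₂.inst v) ϑ)
    (u₂' : ∀ n ≤ m, ∀ ϑ v, StateEnv.Le W.θ₂ ϑ → UVal lp n A₂ v ϑ →
      UExp lp n τ.ty p (b₂'.inst v) ϑ) :
    BExp lp 𝒜 m τ (.caseOf e₁ b₁ b₁') (.caseOf e₂ b₂ b₂') W L L := by
  refine h.bind (K₁ := (.caseOf · b₁ b₁')) (K₂ := (.caseOf · b₂ b₂')) (.caseOf _ _) (.caseOf _ _)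
    fun n hn W' v v' hW' hv => ?_
  by_cases hs : 𝒜.Sees p
  · have hb := hv.bVal hs
    simp only [BVal] at hb
    obtain ⟨w, w', rfl, rfl, hw⟩ | ⟨w, w', rfl, rfl, hw⟩ := hb
    · replace hw : BValA lp 𝒜 n ⟨A₁, p₁⟩ w w' W' := hw
      exact .of_pureRedex (.caseL hw.unary.1.isValue _ _) (.caseL hw.unary.2.isValue _ _)
        fun k hk => h₁ k (hk.le.trans hn) W' w w' hW' (hw.mono hk.le (.refl _))
    · replace hw : BValA lp 𝒜 n ⟨A₂, p₂⟩ w w' W' := hw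
      exact .of_pureRedex (.caseR hw.unary.1.isValue _ _) (.caseR hw.unary.2.isValue _ _)
        fun k hk => h₂ k (hk.le.trans hn) W' w w' hW' (hw.mono hk.le (.refl _))
  · refine .of_not_sees (pc := p) hs (fun h => hs (h.mono hp)) ?_ ?_ (.refl L)
    · exact hv.unary.1.uExp.caseOf
        (fun k hk ϑ w hϑ => u₁ k (hk.trans hn) ϑ w (hW'.1.trans hϑ))
        (fun k hk ϑ w hϑ => u₁' k (hk.trans hn) ϑ w (hW'.1.trans hϑ))
    · exact hv.unary.2.uExp.caseOf
        (fun k hk ϑ w hϑ => u₂ k (hk.trans hn) ϑ w (hW'.2.1.trans hϑ))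
        (fun k hk ϑ w hϑ => u₂' k (hk.trans hn) ϑ w (hW'.2.1.trans hϑ))

/-- If the function is invisible, the two runs may call different functions, whose effects and results
are then invisible. -/
theorem BExp.app (h₁ : BExp lp 𝒜 m ⟨.arrow L' pc A₁ p₁ A₂ p₂, p⟩ e₁ e₂ W L L)
    (h₂ : BExp lp 𝒜 m ⟨A₁, p₁⟩ e₁' e₂' W L L) (hp : p.le p₂) (hpc : p.le pc) (hL : L' ⊆ L) :
    BExp lp 𝒜 m ⟨A₂, p₂⟩ (.app e₁ e₁') (.app e₂ e₂') W L L := by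
  refine h₁.bind (K₁ := (.app · e₁')) (K₂ := (.app · e₂')) (.appL _) (.appL _)
    fun n hn W' v v' hW' hv => ?_
  obtain ⟨hu, hu'⟩ := hv.unary
  have hlam := hu
  have hlam' := hu'
  simp only [UVal] at hlam hlam'
  obtain ⟨b, rfl, -⟩ := hlam
  obtain ⟨b', rfl, -⟩ := hlam'
  refine (h₂.mono hn hW').bind (.appR b) (.appR b') fun k hk W'' w w' hW'' hw => ?_
  by_cases hs : 𝒜.Sees p
  · have hb := hv.bVal hs
    rw [BVal] at hb
    obtain ⟨⟨_, _, ⟨⟩, ⟨⟩, hb⟩, -⟩ := hb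
    exact .of_pureRedex (.app b hw.unary.1.isValue) (.app b' hw.unary.2.isValue) fun j hj =>
      hb j (hj.trans_le hk) W'' hW'' w w' (hw.mono hj.le (.refl _)) L L hL hL (.refl L)
  · exact .of_not_sees (pc := pc) (fun h => hs (h.mono hpc)) (fun h => hs (h.mono hp))
      ((hu.mono hk hW''.1).uExp.app hw.unary.1.uExp pc.le_refl)
      ((hu'.mono hk hW''.2.1).uExp.app hw.unary.2.uExp pc.le_refl) (.refl L)

theorem BExp.deref (h : BExp lp 𝒜 m ⟨.ref A q, p⟩ e₁ e₂ W L L) (hp : p.le τ.pol)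
    (hsub : SubA ⟨A, q⟩ τ) : BExp lp 𝒜 m τ (.deref e₁) (.deref e₂) W L L := by
  refine h.bind .deref .deref fun n _ W' v v' _ hv => ?_
  obtain ⟨hu, hu'⟩ := hv.unary
  simp only [UVal] at hu hu'
  obtain ⟨l, rfl, hl⟩ := hu
  obtain ⟨l', rfl, hl'⟩ := hu'
  refine .of_cPar nofun nofun ?_
  intro L₁ L₂ _ _ k hk W'' S₁ S₂ hW'' hS _ _ _ _ _ _ _ _ hs₁ hs₂ _
  cases hs₁ with
  | deref h => cases h
  | @derefBeta _ _ _ w τ₁ hw =>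
  cases hs₂ with
  | deref h => cases h
  | @derefBeta _ _ _ w' τ₂ hw' =>
  refine ⟨W'', .refl _, hS, .refl nofun, BValA.bExp ?_⟩
  obtain ⟨rfl, hwu⟩ := hS.1.eq_of_lookup (hW''.1 _ _ hl) hw
  obtain ⟨rfl, hwu'⟩ := hS.2.1.eq_of_lookup (hW''.2.1 _ _ hl') hw'
  by_cases hs : 𝒜.Sees p
  · have hb := hv.bVal hs
    simp only [BVal] at hb
    obtain ⟨_, _, ⟨⟩, ⟨⟩, -, -, hβ⟩ := hb
    obtain ⟨ρ, w₁, w₂, -, -, hw₁, hw₂, hρ⟩ := hS.2.2 l l' (hW''.2.2 _ _ hβ)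
    obtain ⟨rfl, rfl⟩ := Prod.mk.inj (Option.some.inj (hw.symm.trans hw₁))
    obtain ⟨rfl, -⟩ := Prod.mk.inj (Option.some.inj (hw'.symm.trans hw₂))
    exact hρ.sub hsub
  · exact .of_not_sees (fun h => hs (h.mono hp)) (hwu.sub hsub.2) (hwu'.sub hsub.2)

/-- The values of two writes at the type `τ'`, whose steps have to be matched, are related at `τ'`. At a
visible type this is where relevant declassification matters: either the observations are irrelevant,
which asserts the claim, or an active lock set is within the capability of the attacker, so that the
type `τ` of the values before specialization is visible already. -/
theorem BValA.of_write {l l' : Loc} (hv : BValA lp 𝒜 m τ v v' W)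
    (hsub : SubA (τ.specialize L) τ')
    (hrel : ObsIrrel lp 𝒜 (BValA lp 𝒜 m) W (.write l τ' v) (.write l' τ' v') ∨
      L₁ ⊆ 𝒜.cap ∨ L₂ ⊆ 𝒜.cap) (hL₁ : L ⊆ L₁) (hL₂ : L ⊆ L₂) : BValA lp 𝒜 m τ' v v' W := by
  by_cases hs : 𝒜.Sees τ'.pol
  · have hcap : L ⊆ 𝒜.cap → BValA lp 𝒜 m τ' v v' W := fun hL =>
      .inl ⟨hs, (binary_sub m).1 hsub.2 (hv.bVal (.of_specialize (hs.mono hsub.1) hL))⟩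
    obtain h | h | h := hrel
    · cases h with
      | refl h => exact absurd rfl (h _ _ _)
      | high h => exact (h.elim id id ⟨_, rfl, hs⟩).elim
      | extend h => exact h
    · exact hcap (hL₁.trans h)
    · exact hcap (hL₂.trans h)
  · exact .of_not_sees hs (hv.unary.1.sub hsub.2) (hv.unary.2.sub hsub.2)

theorem StateRel.env_ne_none_left {l l' : Loc} (hS : StateRel lp m (BValA lp 𝒜 m) S₁ S₂ W)
    (hβ : W.β l l') : W.θ₁ l ≠ none := by
  obtain ⟨ρ, _, _, h, -⟩ := hS.2.2 l l' hβ
  simp [h]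

theorem StateRel.env_ne_none_right {l l' : Loc} (hS : StateRel lp m (BValA lp 𝒜 m) S₁ S₂ W)
    (hβ : W.β l l') : W.θ₂ l' ≠ none := by
  obtain ⟨ρ, _, _, -, h, -⟩ := hS.2.2 l l' hβ
  simp [h]

/-- The world that extends `W` by two matched fresh locations `l` and `l'` of type `τ`. -/
def World.alloc (W : World Actor Lock) (l l' : Loc) (τ : ATy Actor Lock)
    (h : ∀ k, ¬ W.β l k) (h' : ∀ k, ¬ W.β k l') : World Actor Lock where
  θ₁ := Function.update W.θ₁ l (some τ)
  θ₂ := Function.update W.θ₂ l' (some τ)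
  β k k' := W.β k k' ∨ k = l ∧ k' = l'
  functional := by
    rintro k k₁ k₂ (h₁ | ⟨rfl, rfl⟩) (h₂ | ⟨h₂, rfl⟩)
    · exact W.functional k k₁ k₂ h₁ h₂
    · exact absurd (h₂ ▸ h₁) (h k₁)
    · exact absurd h₂ (h k₂)
    · rfl
  injective := by
    rintro k k₁ k₂ (h₁ | ⟨rfl, rfl⟩) (h₂ | ⟨rfl, h₂⟩)
    · exact W.injective k k₁ k₂ h₁ h₂
    · exact absurd (h₂ ▸ h₁) (h' k₁)
    · exact absurd h₂ (h' k₂)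
    · rfl

/-- The new locations are always added to the partial bijection, also at an invisible type, because the
type of the reference itself is visible. -/
theorem BExp.new (h : BExp lp 𝒜 m τ e₁ e₂ W L L) (hsub : SubA (τ.specialize L) τ') :
    BExp lp 𝒜 m ⟨.ref τ'.ty τ'.pol, .bot⟩ (.new e₁ τ') (.new e₂ τ') W L L := by
  refine h.bind (K₁ := (.new · τ')) (K₂ := (.new · τ')) (.new τ') (.new τ')
    fun n _ W' v v' _ hv => ?_
  refine .of_cPar nofun nofun ?_
  intro L₁ L₂ hL₁ hL₂ k hk W₀ S₁ S₂ hW₀ hS _ _ _ _ _ _ _ _ hs₁ hs₂ hrel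
  cases hs₁ with
  | new h => exact absurd h hv.unary.1.isValue.not_step
  | @newBeta _ _ _ _ l hvv hl =>
  cases hs₂ with
  | new h => exact absurd h hv.unary.2.isValue.not_step
  | @newBeta _ _ _ _ l' hvv' hl' =>
  have hb : BValA lp 𝒜 k τ' v v' W₀ := (hv.mono hk.le hW₀).of_write hsub hrel hL₁ hL₂
  have hθ := hS.1.env_eq_none hl
  have hθ' := hS.2.1.env_eq_none hl'
  let W₁ := W₀.alloc l l' τ' (fun j hj => hS.env_ne_none_left hj hθ)
    (fun j hj => hS.env_ne_none_right hj hθ')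
  have hle : W₀.Le W₁ := ⟨.update hθ τ', .update hθ' τ', fun _ _ => .inl⟩
  have hself : W₁.θ₁ l = some τ' := Function.update_self ..
  have hself' : W₁.θ₂ l' = some τ' := Function.update_self ..
  have hb' := hb.mono le_rfl hle
  refine ⟨W₁, hle, ⟨?_, ?_, ?_⟩, ?_, (BVal.bValA_bot ?_).bExp⟩
  · exact hS.1.set hle.1 (fun j hj => Function.update_of_ne hj ..) hself hvv hb'.unary.1
  · exact hS.2.1.set hle.2.1 (fun j hj => Function.update_of_ne hj ..) hself' hvv' hb'.unary.2
  · rintro j j' (hj | ⟨rfl, rfl⟩)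
    · obtain ⟨ρ, w, w', hρ, hρ', hw, hw', hbw⟩ := hS.2.2 j j' hj
      have hjl : j ≠ l := by rintro rfl; exact hS.env_ne_none_left hj hθ
      have hjl' : j' ≠ l' := by rintro rfl; exact hS.env_ne_none_right hj hθ'
      exact ⟨ρ, w, w', hle.1 _ _ hρ, hle.2.1 _ _ hρ', by rwa [S₁.lookup_set_of_ne _ _ _ hjl],
        by rwa [S₂.lookup_set_of_ne _ _ _ hjl'], hbw.mono le_rfl hle⟩
    · exact ⟨τ', v, v', hself, hself', S₁.lookup_set_self .., S₂.lookup_set_self .., hb'⟩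
  · exact .extend hb' (.inr ⟨rfl, rfl⟩)
  · rw [BVal]
    exact ⟨l, l', rfl, rfl, hself, hself', .inr ⟨rfl, rfl⟩⟩

/-- If the references are invisible, the two runs may write to unmatched locations, whose type is then
invisible. -/
theorem BExp.assign (h₁ : BExp lp 𝒜 m ⟨.ref A q, p⟩ e₁ e₂ W L L)
    (hsub : SubA (τ.specialize L) ⟨A, q⟩) (h₂ : BExp lp 𝒜 m τ e₁' e₂' W L L) (hp : p.le q) :
    BExp lp 𝒜 m ⟨.unit, .bot⟩ (.assign e₁ e₁') (.assign e₂ e₂') W L L := by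
  refine h₁.bind (K₁ := (.assign · e₁')) (K₂ := (.assign · e₂')) (.assignL _) (.assignL _)
    fun n hn W' v v' hW' hv => ?_
  obtain ⟨hu, hu'⟩ := hv.unary
  simp only [UVal] at hu hu'
  obtain ⟨l, rfl, hl⟩ := hu
  obtain ⟨l', rfl, hl'⟩ := hu'
  refine (h₂.mono hn hW').bind (.assignR l) (.assignR l') fun k hk W'' w w' hW'' hw => ?_
  refine .of_cPar nofun nofun ?_
  intro L₁ L₂ hL₁ hL₂ j hj W₀ S₁ S₂ hW₀ hS _ _ _ _ _ _ _ _ hs₁ hs₂ hrel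
  cases hs₁ with
  | assignL h => cases h
  | assignR h => exact absurd h hw.unary.1.isValue.not_step
  | assignBeta hvv hlk =>
  cases hs₂ with
  | assignL h => cases h
  | assignR h => exact absurd h hw.unary.2.isValue.not_step
  | assignBeta hvv' hlk' =>
  have hθ := (hW''.trans hW₀).1 _ _ hl
  have hθ' := (hW''.trans hW₀).2.1 _ _ hl'
  obtain ⟨rfl, -⟩ := hS.1.eq_of_lookup hθ hlk
  obtain ⟨rfl, -⟩ := hS.2.1.eq_of_lookup hθ' hlk'
  have hb : BValA lp 𝒜 j ⟨A, q⟩ w w' W₀ := (hw.mono hj.le hW₀).of_write hsub hrel hL₁ hL₂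
  have hβ : 𝒜.Sees q → W₀.β l l' := by
    intro hs
    have hb := hv.bVal (hs.mono hp)
    simp only [BVal] at hb
    obtain ⟨_, _, ⟨⟩, ⟨⟩, -, -, hβ⟩ := hb
    exact (hW''.trans hW₀).2.2 _ _ hβ
  have hwf := hS.1.set (.refl _) (fun _ _ => rfl) hθ hvv hb.unary.1
  have hwf' := hS.2.1.set (.refl _) (fun _ _ => rfl) hθ' hvv' hb.unary.2
  refine ⟨W₀, .refl _, ⟨hwf, hwf', fun i i' hi => ?_⟩, ?_,
    (BVal.bValA_bot (by rw [BVal]; exact ⟨rfl, rfl⟩)).bExp⟩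
  · obtain ⟨ρ, x, x', hρ, hρ', hx, hx', hbx⟩ := hS.2.2 i i' hi
    -- at a visible type, `l` and `l'` are matched with each other and with no other location; at an
    -- invisible type, well-formedness of the two new states is all that is needed
    by_cases hsρ : 𝒜.Sees ρ.pol
    · by_cases hil : i = l
      · subst hil
        obtain rfl : ρ = ⟨A, q⟩ := Option.some.inj (hρ.symm.trans hθ)
        obtain rfl : i' = l' := W₀.functional i i' l' hi (hβ hsρ)
        exact ⟨_, w, w', hθ, hθ', S₁.lookup_set_self .., S₂.lookup_set_self .., hb⟩
      · have hil' : i' ≠ l' := by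
          rintro rfl
          obtain rfl : ρ = ⟨A, q⟩ := Option.some.inj (hρ'.symm.trans hθ')
          exact hil (W₀.injective i' i l hi (hβ hsρ))
        exact ⟨ρ, x, x', hρ, hρ', by rwa [S₁.lookup_set_of_ne _ _ _ hil],
          by rwa [S₂.lookup_set_of_ne _ _ _ hil'], hbx⟩
    · obtain ⟨y, hy, hyu⟩ := hwf i ρ hρ
      obtain ⟨y', hy', hyu'⟩ := hwf' i' ρ hρ'
      exact ⟨ρ, y, y', hρ, hρ', hy, hy', .of_not_sees hsρ hyu hyu'⟩
  · by_cases hs : 𝒜.Sees q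
    · exact .extend hb (hβ hs)
    · have hvis : ∀ l w, ¬ (Obs.write l ⟨A, q⟩ w : Obs Actor Lock).Visible lp 𝒜 := by
        rintro l w ⟨_, ⟨⟩, h⟩
        exact hs h
      exact .high (hvis _ _) (hvis _ _)

/-- The open locks of the two runs contain the same visible locks, so the runs agree on whether the
visible lock `σ` is open. The answer may change from one step to the next. -/
theorem BExp.whenOpen_of_sees {σ : Lock} (hσ : 𝒜.Sees (lp σ))
    (h₁ : BExp lp 𝒜 m τ e₁ e₂ W (L ∪ {σ}) (L ∪ {σ})) (h₂ : BExp lp 𝒜 m τ e₁' e₂' W L L) :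
    BExp lp 𝒜 m τ (.whenOpen σ e₁ e₁') (.whenOpen σ e₂ e₂') W L L := by
  induction m using Nat.strong_induction_on generalizing e₁ e₂ e₁' e₂' W with
  | _ m ih =>
    refine BExp_iff.2 (.inr ⟨.refl L, fun L₁ L₂ hL₁ hL₂ hL n hn W' S₁ S₂ hW' hS => ?_⟩)
    by_cases hσ₁ : σ ∈ L₁
    · have hσ₂ : σ ∈ L₂ := (hL.mem_iff hσ).1 hσ₁
      obtain hv | ⟨-, h⟩ := BExp_iff.1 h₁
      · refine .inl ⟨nofun, nofun, fun _ _ _ _ _ _ _ _ hs₁ hs₂ _ => ?_⟩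
        cases hs₁ with
        | whenClosed h | whenClosedBeta h => exact absurd hσ₁ h
        | whenOpen _ h => exact absurd h hv.unary.1.isValue.not_step
        | whenOpenBeta =>
        cases hs₂ with
        | whenClosed h | whenClosedBeta h => exact absurd hσ₂ h
        | whenOpen _ h => exact absurd h hv.unary.2.isValue.not_step
        | whenOpenBeta =>
        exact ⟨W', .refl _, hS, .refl nofun, (hv.mono hn.le hW').bExp⟩
      · refine (h L₁ L₂ (Set.union_subset hL₁ (Set.singleton_subset_iff.2 hσ₁))
          (Set.union_subset hL₂ (Set.singleton_subset_iff.2 hσ₂)) hL n hn W' S₁ S₂ hW' hS).frame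
          (K₁ := (.whenOpen σ · e₁')) (K₂ := (.whenOpen σ · e₂'))
          (fun he => ⟨nofun, fun hs => ?_⟩) (fun he => ⟨nofun, fun hs => ?_⟩)
          fun e e' W'' hW'' he => ih n hn he (h₂.mono hn.le (hW'.trans hW''))
        · cases hs with
          | whenClosed h | whenClosedBeta h => exact absurd hσ₁ h
          | whenOpen _ h => exact ⟨_, rfl, h⟩
          | whenOpenBeta _ h => exact absurd h he
        · cases hs with
          | whenClosed h | whenClosedBeta h => exact absurd hσ₂ h
          | whenOpen _ h => exact ⟨_, rfl, h⟩
          | whenOpenBeta _ h => exact absurd h he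
    · have hσ₂ : σ ∉ L₂ := fun h => hσ₁ ((hL.mem_iff hσ).2 h)
      obtain hv | ⟨-, h⟩ := BExp_iff.1 h₂
      · refine .inl ⟨nofun, nofun, fun _ _ _ _ _ _ _ _ hs₁ hs₂ _ => ?_⟩
        cases hs₁ with
        | whenOpen h | whenOpenBeta h => exact absurd h hσ₁
        | whenClosed _ h => exact absurd h hv.unary.1.isValue.not_step
        | whenClosedBeta =>
        cases hs₂ with
        | whenOpen h | whenOpenBeta h => exact absurd h hσ₂
        | whenClosed _ h => exact absurd h hv.unary.2.isValue.not_step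
        | whenClosedBeta =>
        exact ⟨W', .refl _, hS, .refl nofun, (hv.mono hn.le hW').bExp⟩
      · refine (h L₁ L₂ hL₁ hL₂ hL n hn W' S₁ S₂ hW' hS).frame
          (K₁ := (.whenOpen σ e₁)) (K₂ := (.whenOpen σ e₂))
          (fun he => ⟨nofun, fun hs => ?_⟩) (fun he => ⟨nofun, fun hs => ?_⟩)
          fun e e' W'' hW'' he => ih n hn (h₁.mono hn.le (hW'.trans hW'')) he
        · cases hs with
          | whenOpen h | whenOpenBeta h => exact absurd h hσ₁
          | whenClosed _ h => exact ⟨_, rfl, h⟩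
          | whenClosedBeta _ h => exact absurd h he
        · cases hs with
          | whenOpen h | whenOpenBeta h => exact absurd h hσ₂
          | whenClosed _ h => exact ⟨_, rfl, h⟩
          | whenClosedBeta _ h => exact absurd h he

/-! ### The fundamental theorem -/

section Subst

variable {Γ : List (ATy Actor Lock)} {γ₁ γ₂ : ℕ → Expr Actor Lock}

theorem BSubst.cons (h : BSubst lp 𝒜 m Γ γ₁ γ₂ W) (hm : m' ≤ m) (hW : W.Le W')
    (hv : BValA lp 𝒜 m' τ v v' W') :
    BSubst lp 𝒜 m' (τ :: Γ) (consSubst v γ₁) (consSubst v' γ₂) W' := by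
  rintro (_ | i) τ hi
  · obtain rfl : _ = τ := Option.some.inj hi
    exact hv
  · exact (h i τ hi).mono hm hW

theorem BSubst.left (h : BSubst lp 𝒜 m Γ γ₁ γ₂ W) : USubst lp m Γ γ₁ W.θ₁ :=
  fun i τ hi => (h i τ hi).unary.1

theorem BSubst.right (h : BSubst lp 𝒜 m Γ γ₁ γ₂ W) : USubst lp m Γ γ₂ W.θ₂ :=
  fun i τ hi => (h i τ hi).unary.2

end Subst

/-- `W` extends `θ` on both sides and matches every location of `θ` with itself. -/
structure World.Above (θ : StateEnv Actor Lock) (W : World Actor Lock) : Prop where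
  left : StateEnv.Le θ W.θ₁
  right : StateEnv.Le θ W.θ₂
  diag : ∀ l, θ l ≠ none → W.β l l

theorem World.Above.mono (h : W.Above θ) (hW : W.Le W') : W'.Above θ :=
  ⟨h.left.trans hW.1, h.right.trans hW.2.1, fun l hl => hW.2.2 l l (h.diag l hl)⟩

/-- The fundamental theorem for the binary relation. -/
theorem HasType.bExp {Γ : List (ATy Actor Lock)} (h : HasType lp θ Γ L pc e τ)
    {γ₁ γ₂ : ℕ → Expr Actor Lock} (hγ : BSubst lp 𝒜 m Γ γ₁ γ₂ W) (hW : W.Above θ) :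
    BExp lp 𝒜 m τ (e.subst γ₁) (e.subst γ₂) W L L := by
  induction h generalizing m γ₁ γ₂ W with
  | var hi => exact (hγ _ _ hi).bExp
  | unit => exact (BVal.bValA_bot (by rw [BVal]; exact ⟨rfl, rfl⟩)).bExp
  | nat n => exact (BVal.bValA_bot (by rw [BVal]; exact ⟨n, rfl, rfl⟩)).bExp
  | @lam Γ L pc L' pc' e A₁ p₁ A₂ p₂ he ih =>
    have ht : HasType lp θ Γ L pc (.lam e) ⟨.arrow L' pc' A₁ p₁ A₂ p₂, .bot⟩ := .lam he
    refine (BVal.bValA_bot ?_).bExp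
    rw [BVal]
    refine ⟨⟨_, _, rfl, rfl, fun n hn W' hW' w w' hw L₁ L₂ hL₁ hL₂ hL => ?_⟩, ?_, ?_⟩
    · rw [Expr.inst_subst, Expr.inst_subst]
      exact (ih (hγ.cons hn.le hW' hw) (hW.mono hW')).mono_locks hL₁ hL₂ hL
    · exact (UExp_iff.1 (ht.uExp hγ.left hW.left)).resolve_right fun h => h.1 (.lam _)
    · exact (UExp_iff.1 (ht.uExp hγ.right hW.right)).resolve_right fun h => h.1 (.lam _)
  | opn _ _ ih => exact (ih hγ hW).opn
  | opened _ _ ih => exact (ih hγ hW).opened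
  | cls _ _ ih => exact (ih hγ hW).cls
  | closed _ _ ih => exact (ih hγ hW).closed
  | prod _ _ ih₁ ih₂ => exact (ih₁ hγ hW).pair (ih₂ hγ hW)
  | fst _ hp ih => exact (ih hγ hW).fst hp
  | snd _ hp ih => exact (ih hγ hW).snd hp
  | inl _ ih => exact (ih hγ hW).inl
  | inr _ ih => exact (ih hγ hW).inr
  | caseOf _ hp ht₁ ht₂ ih ih₁ ih₂ =>
    refine (ih hγ hW).caseOf hp ?_ ?_ ?_ ?_ ?_ ?_
    · intro n hn W' v v' hW' hv
      rw [Expr.inst_subst, Expr.inst_subst]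
      exact ih₁ (hγ.cons hn hW' hv) (hW.mono hW')
    · intro n hn W' v v' hW' hv
      rw [Expr.inst_subst, Expr.inst_subst]
      exact ih₂ (hγ.cons hn hW' hv) (hW.mono hW')
    all_goals
      intro n hn ϑ v hϑ hv
      rw [Expr.inst_subst]
    · exact (ht₁.uExp (hγ.left.cons hn hϑ hv) (hW.left.trans hϑ)).le_pc
        (Policy.le_join_right _ _)
    · exact (ht₂.uExp (hγ.left.cons hn hϑ hv) (hW.left.trans hϑ)).le_pc
        (Policy.le_join_right _ _)
    · exact (ht₁.uExp (hγ.right.cons hn hϑ hv) (hW.right.trans hϑ)).le_pc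
        (Policy.le_join_right _ _)
    · exact (ht₂.uExp (hγ.right.cons hn hϑ hv) (hW.right.trans hϑ)).le_pc
        (Policy.le_join_right _ _)
  | sub _ _ hsub ih => exact (ih hγ hW).sub hsub (.refl _)
  | app _ _ hp hpc hsub hL ih₁ ih₂ =>
    exact (ih₁ hγ hW).app ((ih₂ hγ hW).sub hsub (.refl _)) hp
      (Policy.le_trans (Policy.le_join_right _ _) hpc) hL
  | deref _ hp hsub ih => exact (ih hγ hW).deref hp hsub
  | new _ _ hsub ih => exact (ih hγ hW).new hsub
  | loc hl =>
    refine (BVal.bValA_bot ?_).bExp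
    rw [BVal]
    exact ⟨_, _, rfl, rfl, hW.left _ _ hl, hW.right _ _ hl, hW.diag _ (by simp [hl])⟩
  | assign _ hsub _ hpc ih₁ ih₂ =>
    exact (ih₁ hγ hW).assign hsub (ih₂ hγ hW)
      (Policy.le_trans (Policy.le_join_right _ _) hpc)
  | @whenOpen Γ L pc σ e₁ e₂ τ ht₁ ht₂ hp ih₁ ih₂ =>
    by_cases hσ : 𝒜.Sees (lp σ)
    · exact .whenOpen_of_sees hσ (ih₁ hγ hW) (ih₂ hγ hW)
    -- the two runs may take different branches, which have invisible effects and results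
    · exact .of_not_sees (pc := pc.join (lp σ)) (fun h => hσ (h.mono (Policy.le_join_right _ _)))
        (fun h => hσ (h.mono hp))
        ((ht₁.uExp hγ.left hW.left).whenOpen (ht₂.uExp hγ.left hW.left))
        ((ht₁.uExp hγ.right hW.right).whenOpen (ht₂.uExp hγ.right hW.right)) (.refl _)

end

end WHR

theorem mainTheorem2 {Actor : Type*} {Lock : Type*} (lp : Lock → WHR.Policy Actor Lock)
    (Γ : List (WHR.ATy Actor Lock)) (L : Set Lock) (θ : WHR.StateEnv Actor Lock)
    (pc : WHR.Policy Actor Lock) (e : WHR.Expr Actor Lock) (τ : WHR.ATy Actor Lock)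
    (he : WHR.HasType lp θ Γ L pc e τ)
    (𝒜 : WHR.Attacker Actor Lock) (m : ℕ) (W : WHR.World Actor Lock)
    (γ₁ γ₂ : ℕ → WHR.Expr Actor Lock) (hγ : WHR.BSubst lp 𝒜 m Γ γ₁ γ₂ W)
    (hθ₁ : WHR.StateEnv.Le θ W.θ₁) (hθ₂ : WHR.StateEnv.Le θ W.θ₂)
    (hβ : ∀ l, θ l ≠ none → W.β l l) :
    WHR.BExp lp 𝒜 m τ (e.subst γ₁) (e.subst γ₂) W L L :=
  he.bExp hγ ⟨hθ₁, hθ₂, hβ⟩
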